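/- Let $k$ be an algebraically closed field of characteristic zero. For a primitive tenth root of unity $u\in k$ let $\mathcal{F}ib_u$ be the Fibonacci modular category over $k$: the semisimple $k$-linear category with simple objects $I,X$ and fusion rule $X\otimes X=I\oplus X$, whose associativity constraint is the identity except on $\mathrm{Hom}(X^{\otimes 3},X)$, where (with the channels ordered $X,I$) it is given by the matrix $\begin{pmatrix} a&1\\-a&-a\end{pmatrix}$ with $a=u+u^{-1}$, whose braiding $c_{X,X}$ is $u$ on the summand $X$ and $u^2$ on the summand $I$ of $X\otimes X$, and whose ribbon twist is $\theta_X=u^{-2}$. Let $\boxtimes$ be the Deligne product (simple objects are pairs of simple objects; all structure is defined factorwise). A commutative algebra $A$ in such a category is called ribbon if $\theta_A=1_A$; it is called separable if the pairing $e=\epsilon\mu:A\otimes A\to I$ is non-degenerate, where $\epsilon:A\to A\otimes A\otimes A^*\to A\otimes A^*\to A^*\otimes A\to I$ is composed of coevaluation, multiplication, braiding and evaluation; it is called indecomposable if it is non-zero and not the direct sum of two non-zero algebras, and simple if it is non-zero and every non-zero homomorphism out of it is injective. (1) Let $u,v\in k$ be primitive tenth roots of unity with $uv\neq 1$ and let $\ell,m\ge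 0$. Then $\mathcal{F}ib_u^{\boxtimes\ell}\boxtimes\mathcal{F}ib_v^{\boxtimes m}$ has no non-trivial indecomposable separable commutative ribbon algebras: every indecomposable separable commutative ribbon algebra in it is isomorphic, as an algebra, to the unit object $I$. (2) For every primitive tenth root of unity $u\in k$, the category $\mathcal{F}ib_u\boxtimes\mathcal{F}ib_{u^{-1}}$ has a separable commutative ribbon algebra which is simple and indecomposable, is not isomorphic to the unit algebra, and whose class in $K_0(\mathcal{F}ib_u\boxtimes\mathcal{F}ib_{u^{-1}})$ is $1+x_1x_2$, where $x_1$ and $x_2$ are the classes of $X\boxtimes I$ and $I\boxtimes X$. -/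

import Mathlib

open CategoryTheory MonoidalCategory

universe w

/-- Skeletal data of a multiplicity-free ribbon fusion category over `k` with set of simple objects
`S`: fusion rules `N_{ab}^c ∈ {0,1}` (`adm a b c` means `N_{ab}^c = 1`), associativity matrices
`F a b c d e f` (the coefficient of the associativity constraint
`(a ⊗ b) ⊗ c → a ⊗ (b ⊗ c)` from the summand `d ⊆ e ⊗ c`, `e ⊆ a ⊗ b`, to the summand
`d ⊆ a ⊗ f`, `f ⊆ b ⊗ c`), their inverses `G`, braiding eigenvalues `R a b c` (the scalar by which
`a ⊗ b → b ⊗ a` maps the summand `c` to the summand `c`) and twists `tw a`,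
subject to the pentagon, triangle, hexagon and balancing identities. -/
structure PremodularData (k : Type w) [Field k] (S : Type) [Fintype S] [DecidableEq S] where
  one : S
  adm : S → S → S → Bool
  F : S → S → S → S → S → S → k
  G : S → S → S → S → S → S → k
  R : S → S → S → k
  tw : S → k
  one_adm : ∀ a c, adm one a c = decide (a = c)
  adm_one : ∀ a c, adm a one c = decide (a = c)
  adm_comm : ∀ a b c, adm a b c = adm b a c
  F_adm : ∀ a b c d e f, F a b c d e f ≠ 0 →
    (adm a b e = true ∧ adm e c d = true) ∧ (adm b c f = true ∧ adm a f d = true)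
  G_adm : ∀ a b c d f e, G a b c d f e ≠ 0 →
    (adm a b e = true ∧ adm e c d = true) ∧ (adm b c f = true ∧ adm a f d = true)
  F_G : ∀ a b c d e e', adm a b e = true → adm e c d = true →
    ∑ f, F a b c d e f * G a b c d f e' = if e = e' then 1 else 0
  G_F : ∀ a b c d f f', adm b c f = true → adm a f d = true →
    ∑ e, G a b c d f e * F a b c d e f' = if f = f' then 1 else 0
  F_one : ∀ a b c, adm a b c = true → F a one b c a b = 1
  pentagon : ∀ a b c d e g h j t,
    F e c d t g h * F a b h t e j =
      ∑ f, F a b c g e f * F a f d t g j * F b c d j f h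
  R_ne_zero : ∀ a b c, R a b c ≠ 0
  hexagon_forward : ∀ a b c d e g,
    ∑ f, F a b c d e f * R a f d * F b c a d f g =
      R a b e * F b a c d e g * R a c g
  hexagon_reverse : ∀ a b c d f g,
    ∑ e, G a b c d f e * R e c d * G c a b d e g =
      R b c f * G a c b d f g * R a c g
  tw_ne_zero : ∀ a, tw a ≠ 0
  tw_one : tw one = 1
  balancing : ∀ a b c, adm a b c = true → tw c = tw a * tw b * (R a b c * R b a c)
  tw_dual : ∀ a b, adm a b one = true → tw a = tw b

/-- The Fibonacci fusion rule `x² = 1 + x` on the labels `false = 1`, `true = x`. -/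
def fibAdm : Bool → Bool → Bool → Bool
  | false, b, c => b == c
  | true, false, c => c
  | true, true, _ => true

/-- The associativity matrix of a Fibonacci category: the only component that is not an identity is
the one on `Hom(x³, x)`, with rows and columns ordered `x, 1`, equal to `[[α, 1], [-α, -α]]`. -/
def fibF {k : Type w} [Field k] (α : k) : Bool → Bool → Bool → Bool → Bool → Bool → k
  | true, true, true, true, true, true => α
  | true, true, true, true, true, false => 1
  | true, true, true, true, false, true => -α
  | true, true, true, true, false, false => -α
  | a, b, c, d, e, f =>
    if fibAdm a b e && fibAdm e c d && fibAdm b c f && fibAdm a f d then 1 else 0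

/-- The inverse of the associativity matrix (the `2 × 2` block is its own inverse). -/
def fibG {k : Type w} [Field k] (α : k) : Bool → Bool → Bool → Bool → Bool → Bool → k
  | true, true, true, true, f, e => fibF α true true true true f e
  | a, b, c, d, f, e => fibF α a b c d e f

/-- The braiding of a Fibonacci category: `c_{x,x}` is `v` on the summand `x` of `x ⊗ x` and `v²`
on the summand `1`. -/
def fibR {k : Type w} [Field k] (v : k) : Bool → Bool → Bool → k
  | true, true, true => v
  | true, true, false => v ^ 2
  | _, _, _ => 1

theorem fib_rel {k : Type w} [Field k] {v : k} (hv : IsPrimitiveRoot v 10) :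
    v ^ 4 - v ^ 3 + v ^ 2 - v + 1 = 0 := by
  have h10 := hv.pow_eq_one
  have h5 : v ^ 5 ≠ 1 := hv.pow_ne_one_of_pos_of_lt (by norm_num) (by norm_num)
  have h2 : v ^ 2 ≠ 1 := hv.pow_ne_one_of_pos_of_lt (by norm_num) (by norm_num)
  have h : (v ^ 5 - 1) * ((v + 1) * (v ^ 4 - v ^ 3 + v ^ 2 - v + 1)) = 0 := by
    linear_combination h10
  have h1 : v + 1 ≠ 0 := fun h => h2 (by linear_combination (v - 1) * h)
  rcases mul_eq_zero.1 h with h | h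
  · exact absurd (sub_eq_zero.1 h) h5
  · exact (mul_eq_zero.1 h).resolve_left h1


section FibIdentities
variable {k : Type w} [Field k] {α v : k}

theorem fibF_mul_fibG (h2 : α ^ 2 = α + 1) (a b c d e e' : Bool) :
    fibAdm a b e = true → fibAdm e c d = true →
    ∑ f, fibF α a b c d e f * fibG α a b c d f e' = if e = e' then 1 else 0 := by
  revert a b c d e e'
  rintro (_|_) (_|_) (_|_) (_|_) (_|_) (_|_) <;> simp [fibF, fibG, fibAdm] <;>
    first | ring1 | linear_combination h2

theorem fibG_mul_fibF (h2 : α ^ 2 = α + 1) (a b c d f f' : Bool) :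
    fibAdm b c f = true → fibAdm a f d = true →
    ∑ e, fibG α a b c d f e * fibF α a b c d e f' = if f = f' then 1 else 0 := by
  revert a b c d f f'
  rintro (_|_) (_|_) (_|_) (_|_) (_|_) (_|_) <;> simp [fibF, fibG, fibAdm] <;>
    first | ring1 | linear_combination h2

set_option maxHeartbeats 4000000 in
theorem fibF_pentagon (h2 : α ^ 2 = α + 1) (a b c d e g h j t : Bool) :
    fibF α e c d t g h * fibF α a b h t e j =
      ∑ f, fibF α a b c g e f * fibF α a f d t g j * fibF α b c d j f h := by
  have h3 : α ^ 3 = 2 * α + 1 := by linear_combination (α + 1) * h2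
  revert a b c d e g h j t
  rintro (_|_) (_|_) (_|_) (_|_) (_|_) (_|_) (_|_) (_|_) (_|_) <;>
    simp [fibF, fibAdm] <;>
    first | ring1 | linear_combination h2 | linear_combination h3 - h2 |
      linear_combination -h2 | linear_combination α * h2 | linear_combination -α * h2

theorem fib_hexagon_forward (h1 : α * v = v ^ 2 + 1) (h2 : α ^ 2 = α + 1)
    (a b c d e g : Bool) :
    ∑ f, fibF α a b c d e f * fibR v a f d * fibF α b c a d f g =
      fibR v a b e * fibF α b a c d e g * fibR v a c g := by
  have h5 : v ^ 3 = α * v - α := by linear_combination -v * h1 - α * h1 + v * h2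
  have h6 : α * v ^ 2 = α * v + v - α := by linear_combination -α * h1 + v * h2
  revert a b c d e g
  rintro (_|_) (_|_) (_|_) (_|_) (_|_) (_|_) <;> simp [fibF, fibR, fibAdm] <;>
    first | ring1 | linear_combination -h5 | linear_combination α * h1 |
      linear_combination α * h5 | linear_combination α * v * h5 + α * h6

theorem fib_hexagon_reverse (h1 : α * v = v ^ 2 + 1) (h2 : α ^ 2 = α + 1)
    (a b c d f g : Bool) :
    ∑ e, fibG α a b c d f e * fibR v e c d * fibG α c a b d e g =
      fibR v b c f * fibG α a c b d f g * fibR v a c g := by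
  have h5 : v ^ 3 = α * v - α := by linear_combination -v * h1 - α * h1 + v * h2
  have h6 : α * v ^ 2 = α * v + v - α := by linear_combination -α * h1 + v * h2
  revert a b c d f g
  rintro (_|_) (_|_) (_|_) (_|_) (_|_) (_|_) <;> simp [fibF, fibG, fibR, fibAdm] <;>
    first | ring1 | linear_combination -h5 | linear_combination α * h1 |
      linear_combination α * h5 | linear_combination α * v * h5 + α * h6

end FibIdentities

theorem fib_mul_self {k : Type w} [Field k] {v : k} (hv : IsPrimitiveRoot v 10) :
    (v + v⁻¹) * v = v ^ 2 + 1 := by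
  have hv0 : v ≠ 0 := hv.ne_zero (by norm_num)
  field_simp

theorem fib_golden {k : Type w} [Field k] {v : k} (hv : IsPrimitiveRoot v 10) :
    (v + v⁻¹) ^ 2 = (v + v⁻¹) + 1 := by
  have hv0 : v ≠ 0 := hv.ne_zero (by norm_num)
  have hr := fib_rel hv
  field_simp
  linear_combination hr

/-- The modular category `Fib_v` for a primitive tenth root of unity `v`: associativity with
`α = v + v⁻¹`, braiding `(v, v²)` and twist `θ_x = v⁻²`. -/
def fibData {k : Type w} [Field k] (v : k) (hv : IsPrimitiveRoot v 10) :
    PremodularData k Bool where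
  one := false
  adm := fibAdm
  F := fibF (v + v⁻¹)
  G := fibG (v + v⁻¹)
  R := fibR v
  tw := fun a => if a then v⁻¹ ^ 2 else 1
  one_adm := by decide
  adm_one := by decide
  adm_comm := by decide
  F_adm := by
    rintro (_|_) (_|_) (_|_) (_|_) (_|_) (_|_) <;> simp [fibF, fibAdm]
  G_adm := by
    rintro (_|_) (_|_) (_|_) (_|_) (_|_) (_|_) <;> simp [fibF, fibG, fibAdm]
  F_G := fibF_mul_fibG (fib_golden hv)
  G_F := fibG_mul_fibF (fib_golden hv)
  F_one := by
    rintro (_|_) (_|_) (_|_) <;> simp [fibF, fibAdm]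
  pentagon := fibF_pentagon (fib_golden hv)
  R_ne_zero := by
    have hv0 : v ≠ 0 := hv.ne_zero (by norm_num)
    rintro (_|_) (_|_) (_|_) <;> simp [fibR, hv0]
  hexagon_forward := fib_hexagon_forward (fib_mul_self hv) (fib_golden hv)
  hexagon_reverse := fib_hexagon_reverse (fib_mul_self hv) (fib_golden hv)
  tw_ne_zero := by
    have hv0 : v ≠ 0 := hv.ne_zero (by norm_num)
    rintro (_|_) <;> simp [hv0]
  tw_one := by simp
  balancing := by
    have hv0 : v ≠ 0 := hv.ne_zero (by norm_num)
    rintro (_|_) (_|_) (_|_) <;> simp [fibR, fibAdm] <;> field_simp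
  tw_dual := by rintro (_|_) (_|_) <;> simp [fibAdm]

namespace PremodularData
variable {k : Type w} [Field k] {S : Type} [Fintype S] [DecidableEq S]

/-- The Deligne product of a finite family of categories given by `PremodularData`: the simple objects
are families of simple objects, and fusion rules, associativity, braiding and twist are the products
of those of the factors. -/
def pi {I : Type} [Fintype I] [DecidableEq I] (D : I → PremodularData k S) :
    PremodularData k (I → S) where
  one := fun i => (D i).one
  adm := fun a b c => decide (∀ i, (D i).adm (a i) (b i) (c i) = true)
  F := fun a b c d e f => ∏ i, (D i).F (a i) (b i) (c i) (d i) (e i) (f i)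
  G := fun a b c d f e => ∏ i, (D i).G (a i) (b i) (c i) (d i) (f i) (e i)
  R := fun a b c => ∏ i, (D i).R (a i) (b i) (c i)
  tw := fun a => ∏ i, (D i).tw (a i)
  one_adm := by intro a c; simp [(D _).one_adm, funext_iff]
  adm_one := by intro a c; simp [(D _).adm_one, funext_iff]
  adm_comm := by intro a b c; simp [(D _).adm_comm (a _) (b _)]
  F_adm := by
    intro a b c d e f h
    have h' := fun i => (D i).F_adm _ _ _ _ _ _ (Finset.prod_ne_zero_iff.1 h i (Finset.mem_univ i))
    simpa [forall_and] using h'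
  G_adm := by
    intro a b c d e f h
    have h' := fun i => (D i).G_adm _ _ _ _ _ _ (Finset.prod_ne_zero_iff.1 h i (Finset.mem_univ i))
    simpa [forall_and] using h'
  F_G := by
    intro a b c d e e' h1 h2
    simp only [decide_eq_true_eq] at h1 h2
    simp only [← Finset.prod_mul_distrib]
    rw [← Fintype.prod_sum (fun i (f : S) => (D i).F (a i) (b i) (c i) (d i) (e i) f *
      (D i).G (a i) (b i) (c i) (d i) f (e' i))]
    rw [Finset.prod_congr rfl fun i _ => (D i).F_G _ _ _ _ _ _ (h1 i) (h2 i)]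
    simp [Finset.prod_ite_zero, funext_iff]
  G_F := by
    intro a b c d e e' h1 h2
    simp only [decide_eq_true_eq] at h1 h2
    simp only [← Finset.prod_mul_distrib]
    rw [← Fintype.prod_sum (fun i (f : S) => (D i).G (a i) (b i) (c i) (d i) (e i) f *
      (D i).F (a i) (b i) (c i) (d i) f (e' i))]
    rw [Finset.prod_congr rfl fun i _ => (D i).G_F _ _ _ _ _ _ (h1 i) (h2 i)]
    simp [Finset.prod_ite_zero, funext_iff]
  F_one := by
    intro a b c h
    simp only [decide_eq_true_eq] at h
    exact Finset.prod_eq_one fun i _ => (D i).F_one _ _ _ (h i)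
  pentagon := by
    intro a b c d e g h j t
    simp only [← Finset.prod_mul_distrib]
    rw [← Fintype.prod_sum (fun i (f : S) => (D i).F (a i) (b i) (c i) (g i) (e i) f *
      (D i).F (a i) f (d i) (t i) (g i) (j i) * (D i).F (b i) (c i) (d i) (j i) f (h i))]
    exact Finset.prod_congr rfl fun i _ => (D i).pentagon _ _ _ _ _ _ _ _ _
  R_ne_zero := fun a b c => Finset.prod_ne_zero_iff.2 fun i _ => (D i).R_ne_zero _ _ _
  hexagon_forward := by
    intro a b c d e g
    simp only [← Finset.prod_mul_distrib]
    rw [← Fintype.prod_sum (fun i (f : S) => (D i).F (a i) (b i) (c i) (d i) (e i) f *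
      (D i).R (a i) f (d i) * (D i).F (b i) (c i) (a i) (d i) f (g i))]
    exact Finset.prod_congr rfl fun i _ => (D i).hexagon_forward _ _ _ _ _ _
  hexagon_reverse := by
    intro a b c d e g
    simp only [← Finset.prod_mul_distrib]
    rw [← Fintype.prod_sum (fun i (f : S) => (D i).G (a i) (b i) (c i) (d i) (e i) f *
      (D i).R f (c i) (d i) * (D i).G (c i) (a i) (b i) (d i) f (g i))]
    exact Finset.prod_congr rfl fun i _ => (D i).hexagon_reverse _ _ _ _ _ _
  tw_ne_zero := fun a => Finset.prod_ne_zero_iff.2 fun i _ => (D i).tw_ne_zero _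
  tw_one := Finset.prod_eq_one fun i _ => (D i).tw_one
  balancing := by
    intro a b c h
    simp only [decide_eq_true_eq] at h
    simp only [← Finset.prod_mul_distrib]
    exact Finset.prod_congr rfl fun i _ => (D i).balancing _ _ _ (h i)
  tw_dual := by
    intro a b h
    simp only [decide_eq_true_eq] at h
    exact Finset.prod_congr rfl fun i _ => (D i).tw_dual _ _ (h i)

/-- Objects of the semisimple category with simple objects `S`: finite formal direct sums
`⨁ i, lab i` of simple objects. -/
structure Obj (D : PremodularData k S) where
  ι : Type
  [fintype : Fintype ι]
  [decEq : DecidableEq ι]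
  lab : ι → S

attribute [instance] Obj.fintype Obj.decEq

variable {D : PremodularData k S}

/-- Morphisms `⨁ i, lab i ⟶ ⨁ j, lab j`: matrices of scalars, which vanish between different simple
objects (Schur). -/
def homSpace (X Y : Obj D) : Submodule k (Matrix X.ι Y.ι k) where
  carrier := {M | ∀ i j, X.lab i ≠ Y.lab j → M i j = 0}
  add_mem' := fun ha hb i j h => by simp [ha i j h, hb i j h]
  zero_mem' := fun i j _ => rfl
  smul_mem' := fun c M hM i j h => by simp [hM i j h]

instance : Category.{w} (Obj D) where
  Hom X Y := homSpace X Y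
  id X := ⟨1, fun i j h => Matrix.one_apply_ne fun e => h (congrArg X.lab e)⟩
  comp {X Y Z} f g := ⟨f.1 * g.1, fun i j h => by
    rw [Matrix.mul_apply]
    refine Finset.sum_eq_zero fun l _ => ?_
    by_cases h' : X.lab i = Y.lab l
    · rw [g.2 l j (h' ▸ h), mul_zero]
    · rw [f.2 i l h', zero_mul]⟩
  id_comp f := Subtype.ext (Matrix.one_mul _)
  comp_id f := Subtype.ext (Matrix.mul_one _)
  assoc f g h := Subtype.ext (Matrix.mul_assoc _ _ _)

/-- The matrix entries of a morphism. -/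
def entry {X Y : Obj D} (f : X ⟶ Y) (i : X.ι) (j : Y.ι) : k := f.1 i j

theorem hom_ext {X Y : Obj D} {f g : X ⟶ Y} (h : ∀ i j, entry f i j = entry g i j) : f = g :=
  Subtype.ext (Matrix.ext h)

theorem entry_eq_zero {X Y : Obj D} (f : X ⟶ Y) {i : X.ι} {j : Y.ι} (h : X.lab i ≠ Y.lab j) :
    entry f i j = 0 := f.2 i j h

theorem entry_id (X : Obj D) (i j : X.ι) : entry (𝟙 X) i j = if i = j then 1 else 0 :=
  Matrix.one_apply

theorem entry_comp {X Y Z : Obj D} (f : X ⟶ Y) (g : Y ⟶ Z) (i : X.ι) (j : Z.ι) :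
    entry (f ≫ g) i j = ∑ l, entry f i l * entry g l j := Matrix.mul_apply

instance : Preadditive (Obj D) where
  homGroup X Y := inferInstanceAs (AddCommGroup (homSpace X Y))
  add_comp _ _ _ _ _ _ := Subtype.ext (Matrix.add_mul _ _ _)
  comp_add _ _ _ _ _ _ := Subtype.ext (Matrix.mul_add _ _ _)

instance : Linear k (Obj D) where
  homModule X Y := inferInstanceAs (Module k (homSpace X Y))
  smul_comp _ _ _ _ _ _ := Subtype.ext (Matrix.smul_mul _ _ _)
  comp_smul _ _ _ _ _ _ := Subtype.ext (Matrix.mul_smul _ _ _)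

/-- The morphism with given matrix entries. -/
def mkHom {X Y : Obj D} (M : X.ι → Y.ι → k) (h : ∀ i j, X.lab i ≠ Y.lab j → M i j = 0) :
    X ⟶ Y := ⟨Matrix.of M, h⟩

@[simp] theorem entry_mkHom {X Y : Obj D} (M : X.ι → Y.ι → k) (h) (i j) :
    entry (mkHom (X := X) (Y := Y) M h) i j = M i j := rfl

/-- The summands of a tensor product: a summand `c ⊆ lab i ⊗ lab j` for each admissible triple. -/
abbrev TIdx (X Y : Obj D) : Type :=
  {p : X.ι × Y.ι × S // D.adm (X.lab p.1) (Y.lab p.2.1) p.2.2 = true}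

theorem sum_TIdx {X Y : Obj D} (g : TIdx X Y → k) :
    ∑ p, g p = ∑ i, ∑ j, ∑ c,
      if h : D.adm (X.lab i) (Y.lab j) c = true then g ⟨(i, j, c), h⟩ else 0 := by
  have h := Fintype.sum_subtype_add_sum_subtype
    (fun p : X.ι × Y.ι × S => D.adm (X.lab p.1) (Y.lab p.2.1) p.2.2 = true)
    (fun p => if h : D.adm (X.lab p.1) (Y.lab p.2.1) p.2.2 = true then g ⟨p, h⟩ else 0)
  rw [Fintype.sum_prod_type] at h
  simp only [Fintype.sum_prod_type] at h
  rw [← h, Finset.sum_eq_zero (s := Finset.univ (α := {p : X.ι × Y.ι × S // ¬ _}))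
    fun p _ => dif_neg p.2, add_zero]
  exact Finset.sum_congr rfl fun p _ => by rw [dif_pos p.2]

/-- The tensor product of two formal direct sums. -/
abbrev tensorObj (X Y : Obj D) : Obj D where
  ι := TIdx X Y
  lab p := p.1.2.2

/-- The monoidal unit. -/
abbrev unitObj (D : PremodularData k S) : Obj D where
  ι := Unit
  lab _ := D.one

/-- The tensor product of morphisms. -/
def tensorHom {X₁ Y₁ X₂ Y₂ : Obj D} (f : X₁ ⟶ Y₁) (g : X₂ ⟶ Y₂) :
    tensorObj X₁ X₂ ⟶ tensorObj Y₁ Y₂ :=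
  mkHom (fun p q => if p.1.2.2 = q.1.2.2 then entry f p.1.1 q.1.1 * entry g p.1.2.1 q.1.2.1 else 0)
    fun _ _ h => if_neg h

/-- The associativity constraint. -/
def assocHom (X Y Z : Obj D) :
    tensorObj (tensorObj X Y) Z ⟶ tensorObj X (tensorObj Y Z) :=
  mkHom (fun p q =>
    if (p.1.1.1.1 = q.1.1 ∧ p.1.1.1.2.1 = q.1.2.1.1.1) ∧ (p.1.2.1 = q.1.2.1.1.2.1 ∧
      p.1.2.2 = q.1.2.2)
    then D.F (X.lab p.1.1.1.1) (Y.lab p.1.1.1.2.1) (Z.lab p.1.2.1) p.1.2.2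
      p.1.1.1.2.2 q.1.2.1.1.2.2
    else 0) fun _ _ h => if_neg fun h' => h h'.2.2

/-- The inverse of the associativity constraint. -/
def assocInv (X Y Z : Obj D) :
    tensorObj X (tensorObj Y Z) ⟶ tensorObj (tensorObj X Y) Z :=
  mkHom (fun q p =>
    if (q.1.1 = p.1.1.1.1 ∧ q.1.2.1.1.1 = p.1.1.1.2.1) ∧ (q.1.2.1.1.2.1 = p.1.2.1 ∧
      q.1.2.2 = p.1.2.2)
    then D.G (X.lab p.1.1.1.1) (Y.lab p.1.1.1.2.1) (Z.lab p.1.2.1) p.1.2.2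
      q.1.2.1.1.2.2 p.1.1.1.2.2
    else 0) fun _ _ h => if_neg fun h' => h h'.2.2

/-- The left unit constraint. -/
def leftHom (X : Obj D) : tensorObj (unitObj D) X ⟶ X :=
  mkHom (fun p j => if p.1.2.1 = j then 1 else 0) fun p j h => if_neg fun h' => h (by
    have := p.2; rw [D.one_adm] at this; exact (of_decide_eq_true this).symm.trans (congrArg _ h'))

/-- The inverse of the left unit constraint. -/
def leftInv (X : Obj D) : X ⟶ tensorObj (unitObj D) X :=
  mkHom (fun j p => if j = p.1.2.1 then 1 else 0) fun j p h => if_neg fun h' => h (by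
    have := p.2; rw [D.one_adm] at this; exact (congrArg _ h').trans (of_decide_eq_true this))

/-- The right unit constraint. -/
def rightHom (X : Obj D) : tensorObj X (unitObj D) ⟶ X :=
  mkHom (fun p j => if p.1.1 = j then 1 else 0) fun p j h => if_neg fun h' => h (by
    have := p.2; rw [D.adm_one] at this; exact (of_decide_eq_true this).symm.trans (congrArg _ h'))

/-- The inverse of the right unit constraint. -/
def rightInv (X : Obj D) : X ⟶ tensorObj X (unitObj D) :=
  mkHom (fun j p => if j = p.1.1 then 1 else 0) fun j p h => if_neg fun h' => h (by
    have := p.2; rw [D.adm_one] at this; exact (congrArg _ h').trans (of_decide_eq_true this))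


theorem ite_F {a b c d e f : S} (s : k) :
    (if D.adm b c f = true ∧ D.adm a f d = true then D.F a b c d e f * s else 0) =
      D.F a b c d e f * s := by
  split_ifs with h
  · rfl
  · rw [not_not.1 (mt (D.F_adm a b c d e f) fun h' => h h'.2), zero_mul]

theorem ite_G {a b c d e f : S} (s : k) :
    (if D.adm a b e = true ∧ D.adm e c d = true then D.G a b c d f e * s else 0) =
      D.G a b c d f e * s := by
  split_ifs with h
  · rfl
  · rw [not_not.1 (mt (D.G_adm a b c d f e) fun h' => h h'.1), zero_mul]

theorem strip_assocHom (X Y Z : Obj D) {i j e l d h1 h2}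
    (N : (tensorObj X (tensorObj Y Z)).ι → k) :
    ∑ y, entry (assocHom X Y Z) ⟨(⟨(i, j, e), h1⟩, l, d), h2⟩ y * N y =
      ∑ f, if h : D.adm (Y.lab j) (Z.lab l) f = true ∧ D.adm (X.lab i) f d = true then
        D.F (X.lab i) (Y.lab j) (Z.lab l) d e f * N ⟨(i, ⟨(j, l, f), h.1⟩, d), h.2⟩ else 0 := by
  rw [sum_TIdx, Fintype.sum_eq_single i, sum_TIdx, Fintype.sum_eq_single j,
    Fintype.sum_eq_single l]
  · refine Finset.sum_congr rfl fun f _ => ?_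
    by_cases h : D.adm (Y.lab j) (Z.lab l) f = true
    · rw [dif_pos h, Fintype.sum_eq_single d]
      · by_cases h' : D.adm (X.lab i) f d = true <;> simp [h, h', assocHom]
      · intro d' hd
        simp [assocHom, hd.symm]
    · simp [h]
  · intro l' hl
    simp [assocHom, hl.symm]
  · intro l' hl
    simp [assocHom, hl.symm]
  · intro l' hl
    simp [assocHom, hl.symm]

theorem strip_assocInv (X Y Z : Obj D) {i j f l d h1 h2}
    (N : (tensorObj (tensorObj X Y) Z).ι → k) :
    ∑ y, entry (assocInv X Y Z) ⟨(i, ⟨(j, l, f), h1⟩, d), h2⟩ y * N y =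
      ∑ e, if h : D.adm (X.lab i) (Y.lab j) e = true ∧ D.adm e (Z.lab l) d = true then
        D.G (X.lab i) (Y.lab j) (Z.lab l) d f e * N ⟨(⟨(i, j, e), h.1⟩, l, d), h.2⟩ else 0 := by
  rw [sum_TIdx, sum_TIdx, Fintype.sum_eq_single i, Fintype.sum_eq_single j]
  · refine Finset.sum_congr rfl fun e _ => ?_
    by_cases h : D.adm (X.lab i) (Y.lab j) e = true
    · rw [dif_pos h, Fintype.sum_eq_single l, Fintype.sum_eq_single d]
      · by_cases h' : D.adm e (Z.lab l) d = true <;> simp [h, h', assocInv]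
      · intro d' hd
        simp [assocInv, hd.symm]
      · intro l' hl
        simp [assocInv, hl.symm]
    · simp [h]
  · intro l' hl
    simp [assocInv, hl.symm]
  · intro l' hl
    simp [assocInv, hl.symm]

theorem strip_assocHom' (X Y Z : Obj D) {i j e l d h1 h2}
    (N : (tensorObj X (tensorObj Y Z)).ι → k) (N' : S → k)
    (hN : ∀ f h1 h2, N ⟨(i, ⟨(j, l, f), h1⟩, d), h2⟩ = N' f) :
    ∑ y, entry (assocHom X Y Z) ⟨(⟨(i, j, e), h1⟩, l, d), h2⟩ y * N y =
      ∑ f, D.F (X.lab i) (Y.lab j) (Z.lab l) d e f * N' f := by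
  rw [strip_assocHom]
  refine Finset.sum_congr rfl fun f _ => ?_
  simp only [hN, dite_eq_ite, ite_F]

theorem strip_assocInv' (X Y Z : Obj D) {i j f l d h1 h2}
    (N : (tensorObj (tensorObj X Y) Z).ι → k) (N' : S → k)
    (hN : ∀ e h1 h2, N ⟨(⟨(i, j, e), h1⟩, l, d), h2⟩ = N' e) :
    ∑ y, entry (assocInv X Y Z) ⟨(i, ⟨(j, l, f), h1⟩, d), h2⟩ y * N y =
      ∑ e, D.G (X.lab i) (Y.lab j) (Z.lab l) d f e * N' e := by
  rw [strip_assocInv]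
  refine Finset.sum_congr rfl fun f _ => ?_
  simp only [hN, dite_eq_ite, ite_G]

theorem strip_tensorHom_id {X Y : Obj D} (Z : Obj D) (f : X ⟶ Y) {i l c h}
    (N : (tensorObj Y Z).ι → k) :
    ∑ y, entry (tensorHom f (𝟙 Z)) ⟨(i, l, c), h⟩ y * N y =
      ∑ j, entry f i j *
        (if h : D.adm (Y.lab j) (Z.lab l) c = true then N ⟨(j, l, c), h⟩ else 0) := by
  rw [sum_TIdx]
  refine Finset.sum_congr rfl fun j _ => ?_
  rw [Fintype.sum_eq_single l, Fintype.sum_eq_single c]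
  · by_cases h' : D.adm (Y.lab j) (Z.lab l) c = true <;> simp [h', tensorHom, entry_id]
  · intro c' hc
    simp [tensorHom, hc.symm]
  · intro c' hc
    simp [tensorHom, entry_id, hc.symm]

theorem strip_id_tensorHom {X Y : Obj D} (Z : Obj D) (f : X ⟶ Y) {i l c h}
    (N : (tensorObj Z Y).ι → k) :
    ∑ y, entry (tensorHom (𝟙 Z) f) ⟨(l, i, c), h⟩ y * N y =
      ∑ j, entry f i j *
        (if h : D.adm (Z.lab l) (Y.lab j) c = true then N ⟨(l, j, c), h⟩ else 0) := by
  rw [sum_TIdx, Fintype.sum_eq_single l]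
  · refine Finset.sum_congr rfl fun j _ => ?_
    rw [Fintype.sum_eq_single c]
    · by_cases h' : D.adm (Z.lab l) (Y.lab j) c = true <;> simp [h', tensorHom, entry_id]
    · intro c' hc
      simp [tensorHom, hc.symm]
  · intro c' hc
    simp [tensorHom, entry_id, hc.symm]

theorem tensorHom_one (X Y : Obj D) : tensorHom (𝟙 X) (𝟙 Y) = 𝟙 (tensorObj X Y) := by
  refine hom_ext ?_
  rintro ⟨⟨i, j, c⟩, h⟩ ⟨⟨i', j', c'⟩, h'⟩
  simp only [tensorHom, entry_mkHom, entry_id, Subtype.mk.injEq, Prod.mk.injEq]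
  split_ifs <;> simp_all

theorem tensorHom_comp {X₁ Y₁ Z₁ X₂ Y₂ Z₂ : Obj D} (f₁ : X₁ ⟶ Y₁) (f₂ : X₂ ⟶ Y₂)
    (g₁ : Y₁ ⟶ Z₁) (g₂ : Y₂ ⟶ Z₂) :
    tensorHom f₁ f₂ ≫ tensorHom g₁ g₂ = tensorHom (f₁ ≫ g₁) (f₂ ≫ g₂) := by
  refine hom_ext ?_
  rintro ⟨⟨i, j, c⟩, h⟩ ⟨⟨i', j', c'⟩, h'⟩
  rw [entry_comp, sum_TIdx]
  simp only [tensorHom, entry_mkHom, entry_comp]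
  by_cases hc : c = c'
  · subst hc
    rw [if_pos rfl, Finset.sum_mul_sum]
    refine Finset.sum_congr rfl fun x _ => Finset.sum_congr rfl fun y _ => ?_
    rw [Fintype.sum_eq_single c]
    · by_cases hx : X₁.lab i = Y₁.lab x
      · by_cases hy : X₂.lab j = Y₂.lab y
        · have hh : D.adm (Y₁.lab x) (Y₂.lab y) c = true := hx ▸ hy ▸ h
          simp only [hh, dite_true, if_true]
          ring
        · simp [entry_eq_zero _ hy]
      · simp [entry_eq_zero _ hx]
    · intro c' hc
      simp [hc]
  · rw [if_neg hc]
    refine Finset.sum_eq_zero fun x _ => Finset.sum_eq_zero fun y _ => Finset.sum_eq_zero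
      fun z _ => ?_
    by_cases hz : c = z
    · subst hz; simp [hc]
    · simp [hz]

theorem left_hom_inv (X : Obj D) : leftHom X ≫ leftInv X = 𝟙 _ := by
  refine hom_ext ?_
  rintro ⟨⟨_, i, c⟩, h⟩ ⟨⟨_, j, d⟩, h'⟩
  have h1 := D.one_adm (X.lab i) c
  have h2 := D.one_adm (X.lab j) d
  dsimp only at h h'
  rw [h] at h1; rw [h'] at h2
  simp only [true_eq_decide_iff] at h1 h2
  subst h1 h2
  simp only [entry_comp, leftHom, leftInv, entry_mkHom, entry_id]
  by_cases hh : i = j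
  · subst hh; simp
  · simp [hh]

theorem left_inv_hom (X : Obj D) : leftInv X ≫ leftHom X = 𝟙 _ := by
  refine hom_ext fun i j => ?_
  rw [entry_comp, sum_TIdx]
  by_cases hh : i = j
  · subst hh
    simp [leftHom, leftInv, entry_id, D.one_adm]
  · simp [leftHom, leftInv, entry_id, D.one_adm, hh]

theorem right_hom_inv (X : Obj D) : rightHom X ≫ rightInv X = 𝟙 _ := by
  refine hom_ext ?_
  rintro ⟨⟨i, _, c⟩, h⟩ ⟨⟨j, _, d⟩, h'⟩
  have h1 := D.adm_one (X.lab i) c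
  have h2 := D.adm_one (X.lab j) d
  dsimp only at h h'
  rw [h] at h1; rw [h'] at h2
  simp only [true_eq_decide_iff] at h1 h2
  subst h1 h2
  simp only [entry_comp, rightHom, rightInv, entry_mkHom, entry_id]
  by_cases hh : i = j
  · subst hh; simp
  · simp [hh]

theorem right_inv_hom (X : Obj D) : rightInv X ≫ rightHom X = 𝟙 _ := by
  refine hom_ext fun i j => ?_
  rw [entry_comp, sum_TIdx]
  by_cases hh : i = j
  · subst hh
    simp [rightHom, rightInv, entry_id, D.adm_one]
  · simp [rightHom, rightInv, entry_id, D.adm_one, hh]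

theorem assoc_hom_inv (X Y Z : Obj D) : assocHom X Y Z ≫ assocInv X Y Z = 𝟙 _ := by
  refine hom_ext ?_
  rintro ⟨⟨⟨⟨i, j, e⟩, h1⟩, l, d⟩, h2⟩ ⟨⟨⟨⟨i', j', e'⟩, h1'⟩, l', d'⟩, h2'⟩
  rw [entry_comp, strip_assocHom]
  simp only [assocInv, entry_mkHom, entry_id, dite_eq_ite, ite_F, Subtype.mk.injEq, Prod.mk.injEq]
  by_cases hi : i = i' <;> by_cases hj : j = j' <;> by_cases hl : l = l' <;>
    by_cases hd : d = d' <;> simp [hi, hj, hl, hd]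
  subst hi hj hl hd
  rw [D.F_G _ _ _ _ _ _ h1 h2]

theorem assoc_inv_hom (X Y Z : Obj D) : assocInv X Y Z ≫ assocHom X Y Z = 𝟙 _ := by
  refine hom_ext ?_
  rintro ⟨⟨i, ⟨⟨j, l, f⟩, h1⟩, d⟩, h2⟩ ⟨⟨i', ⟨⟨j', l', f'⟩, h1'⟩, d'⟩, h2'⟩
  rw [entry_comp, strip_assocInv]
  simp only [assocHom, entry_mkHom, entry_id, dite_eq_ite, ite_G, Subtype.mk.injEq, Prod.mk.injEq]
  by_cases hi : i = i' <;> by_cases hj : j = j' <;> by_cases hl : l = l' <;>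
    by_cases hd : d = d' <;> simp [hi, hj, hl, hd]
  subst hi hj hl hd
  rw [D.G_F _ _ _ _ _ _ h1 h2]

theorem left_nat {X Y : Obj D} (f : X ⟶ Y) :
    tensorHom (𝟙 (unitObj D)) f ≫ leftHom Y = leftHom X ≫ f := by
  refine hom_ext ?_
  rintro ⟨⟨_, i, c⟩, h⟩ j
  rw [entry_comp, entry_comp, strip_id_tensorHom]
  have h1 := D.one_adm (X.lab i) c
  dsimp only at h
  rw [h] at h1
  simp only [true_eq_decide_iff] at h1
  subst h1
  rw [Fintype.sum_eq_single j, Fintype.sum_eq_single i]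
  · by_cases hh : X.lab i = Y.lab j
    · simp [leftHom, D.one_adm, hh]
    · simp [entry_eq_zero f hh]
  · intro x hx
    simp [leftHom, hx.symm]
  · intro x hx
    simp [leftHom, hx]

theorem right_nat {X Y : Obj D} (f : X ⟶ Y) :
    tensorHom f (𝟙 (unitObj D)) ≫ rightHom Y = rightHom X ≫ f := by
  refine hom_ext ?_
  rintro ⟨⟨i, _, c⟩, h⟩ j
  rw [entry_comp, entry_comp, strip_tensorHom_id]
  have h1 := D.adm_one (X.lab i) c
  dsimp only at h
  rw [h] at h1
  simp only [true_eq_decide_iff] at h1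
  subst h1
  rw [Fintype.sum_eq_single j, Fintype.sum_eq_single i]
  · by_cases hh : X.lab i = Y.lab j
    · simp [rightHom, D.adm_one, hh]
    · simp [entry_eq_zero f hh]
  · intro x hx
    simp [rightHom, hx.symm]
  · intro x hx
    simp [rightHom, hx]

theorem right_strip_assocHom (X Y Z : Obj D) {i j f l d h1 h2}
    (N : (tensorObj (tensorObj X Y) Z).ι → k) :
    ∑ y, N y * entry (assocHom X Y Z) y ⟨(i, ⟨(j, l, f), h1⟩, d), h2⟩ =
      ∑ e, if h : D.adm (X.lab i) (Y.lab j) e = true ∧ D.adm e (Z.lab l) d = true then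
        N ⟨(⟨(i, j, e), h.1⟩, l, d), h.2⟩ * D.F (X.lab i) (Y.lab j) (Z.lab l) d e f else 0 := by
  rw [sum_TIdx, sum_TIdx, Fintype.sum_eq_single i, Fintype.sum_eq_single j]
  · refine Finset.sum_congr rfl fun e _ => ?_
    by_cases h : D.adm (X.lab i) (Y.lab j) e = true
    · rw [dif_pos h, Fintype.sum_eq_single l, Fintype.sum_eq_single d]
      · by_cases h' : D.adm e (Z.lab l) d = true <;> simp [h, h', assocHom]
      · intro d' hd
        simp [assocHom, hd]
      · intro l' hl
        simp [assocHom, hl]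
    · simp [h]
  · intro l' hl
    simp [assocHom, hl]
  · intro l' hl
    simp [assocHom, hl]

theorem assoc_nat {X₁ X₂ X₃ Y₁ Y₂ Y₃ : Obj D} (f₁ : X₁ ⟶ Y₁) (f₂ : X₂ ⟶ Y₂) (f₃ : X₃ ⟶ Y₃) :
    tensorHom (tensorHom f₁ f₂) f₃ ≫ assocHom Y₁ Y₂ Y₃ =
      assocHom X₁ X₂ X₃ ≫ tensorHom f₁ (tensorHom f₂ f₃) := by
  refine hom_ext ?_
  rintro ⟨⟨⟨⟨i, j, e⟩, h1⟩, l, d⟩, h2⟩ ⟨⟨i', ⟨⟨j', l', f⟩, h1'⟩, d'⟩, h2'⟩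
  rw [entry_comp, entry_comp, right_strip_assocHom,
    strip_assocHom' (N' := fun f' => if d = d' then entry f₁ i i' *
      (if f' = f then entry f₂ j j' * entry f₃ l l' else 0) else 0)
      (hN := fun f h1 h2 => by simp only [tensorHom, entry_mkHom])]
  by_cases hd : d = d'
  · subst hd
    rw [Fintype.sum_eq_single e, Fintype.sum_eq_single f]
    · by_cases hi : X₁.lab i = Y₁.lab i'
      · by_cases hj : X₂.lab j = Y₂.lab j'
        · by_cases hl : X₃.lab l = Y₃.lab l'
          · have h3 : D.adm (Y₁.lab i') (Y₂.lab j') e = true := hi ▸ hj ▸ h1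
            have h4 : D.adm e (Y₃.lab l') d = true := hl ▸ h2
            simp only [tensorHom, entry_mkHom, hi, hj, hl, h3, h4]
            simp
            ring
          · simp [tensorHom, entry_eq_zero f₃ hl]
        · simp [tensorHom, entry_eq_zero f₂ hj]
      · simp [tensorHom, entry_eq_zero f₁ hi]
    · intro x hx
      simp [hx]
    · intro x hx
      rw [dite_eq_right_iff]
      intro h
      simp [tensorHom, hx.symm]
  · simp [tensorHom, hd]

theorem triangle_cat (X Y : Obj D) :
    assocHom X (unitObj D) Y ≫ tensorHom (𝟙 X) (leftHom Y) = tensorHom (rightHom X) (𝟙 Y) := by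
  refine hom_ext ?_
  rintro ⟨⟨⟨⟨i, _, e⟩, h1⟩, l, d⟩, h2⟩ ⟨⟨i', l', d'⟩, h2'⟩
  have h3 := D.adm_one (X.lab i) e
  dsimp only at h1
  rw [h1] at h3
  simp only [true_eq_decide_iff] at h3
  subst h3
  rw [entry_comp]
  refine (strip_assocHom' X (unitObj D) Y (N := fun y => entry (tensorHom (𝟙 X) (leftHom Y)) y _)
    (N' := fun _ => if d = d' then (if i = i' then 1 else 0) *
    (if l = l' then 1 else 0) else 0) ?_).trans ?_
  · intro f h1 h2
    simp only [tensorHom, leftHom, entry_mkHom, entry_id]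
  · simp only [tensorHom, rightHom, entry_mkHom, entry_id]
    rw [Fintype.sum_eq_single (Y.lab l)]
    · rw [D.F_one _ _ _ h2, one_mul]
    · intro x hx
      rw [not_not.1 (mt (D.F_adm _ _ _ _ _ _) fun h' => ?_), zero_mul]
      have := h'.2.1
      rw [D.one_adm] at this
      exact hx (of_decide_eq_true this).symm

theorem pentagon_cat (W X Y Z : Obj D) :
    tensorHom (assocHom W X Y) (𝟙 Z) ≫
        assocHom W (tensorObj X Y) Z ≫ tensorHom (𝟙 W) (assocHom X Y Z) =
      assocHom (tensorObj W X) Y Z ≫ assocHom W X (tensorObj Y Z) := by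
  refine hom_ext ?_
  rintro ⟨⟨⟨⟨⟨⟨i, j, e⟩, h1⟩, l, g⟩, h2⟩, m, t⟩, h3⟩
    ⟨⟨i', ⟨⟨j', ⟨⟨l', m', r'⟩, h1'⟩, g'⟩, h2'⟩, t'⟩, h3'⟩
  have key : ∀ x h1 h2 h3, entry (assocHom W (tensorObj X Y) Z ≫ tensorHom (𝟙 W) (assocHom X Y Z))
      ⟨(⟨(i, ⟨(j, l, x), h1⟩, g), h2⟩, m, t), h3⟩
      ⟨(i', ⟨(j', ⟨(l', m', r'), h1'⟩, g'), h2'⟩, t'), h3'⟩ =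
      if (i = i' ∧ j = j') ∧ (l = l' ∧ m = m') ∧ t = t' then
        D.F (W.lab i) x (Z.lab m) t g g' * D.F (X.lab j) (Y.lab l) (Z.lab m) g' x r' else 0 := by
    intro x h1 h2 h3
    rw [entry_comp, strip_assocHom' (N' := fun f => if t = t' then (if i = i' then 1 else 0) *
      (if (j = j' ∧ l = l') ∧ (m = m' ∧ f = g') then
        D.F (X.lab j) (Y.lab l) (Z.lab m) f x r' else 0) else 0)
      (hN := fun f h1 h2 => by simp only [assocHom, tensorHom, entry_mkHom, entry_id])]
    by_cases hi : i = i' <;> by_cases hj : j = j' <;> by_cases hl : l = l' <;>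
      by_cases hm : m = m' <;> by_cases ht : t = t' <;> simp [hi, hj, hl, hm, ht]
  rw [entry_comp, entry_comp, strip_tensorHom_id, strip_assocHom, strip_assocHom]
  simp only [key]
  dsimp only at h3
  simp only [assocHom, entry_mkHom, Subtype.mk.injEq, Prod.mk.injEq, dite_eq_ite, h3, if_true, ite_F]
  by_cases hi : i = i' <;> by_cases hj : j = j' <;> by_cases hl : l = l' <;>
    by_cases hm : m = m' <;> by_cases ht : t = t' <;> simp [hi, hj, hl, hm, ht]
  subst hi hj hl hm ht
  rw [D.pentagon]
  exact Finset.sum_congr rfl fun f _ => (mul_assoc _ _ _).symm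

instance : MonoidalCategoryStruct (Obj D) where
  tensorObj := tensorObj
  tensorUnit := unitObj D
  tensorHom := tensorHom
  whiskerLeft X _ _ f := tensorHom (𝟙 X) f
  whiskerRight f Y := tensorHom f (𝟙 Y)
  associator X Y Z := ⟨assocHom X Y Z, assocInv X Y Z, assoc_hom_inv X Y Z, assoc_inv_hom X Y Z⟩
  leftUnitor X := ⟨leftHom X, leftInv X, left_hom_inv X, left_inv_hom X⟩
  rightUnitor X := ⟨rightHom X, rightInv X, right_hom_inv X, right_inv_hom X⟩

instance : MonoidalCategory (Obj D) :=
  MonoidalCategory.ofTensorHom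
    (id_tensorHom_id := tensorHom_one)
    (id_tensorHom := fun _ _ _ _ => rfl)
    (tensorHom_id := fun _ _ => rfl)
    (tensorHom_comp_tensorHom := tensorHom_comp)
    (associator_naturality := assoc_nat)
    (leftUnitor_naturality := left_nat)
    (rightUnitor_naturality := right_nat)
    (pentagon := pentagon_cat)
    (triangle := triangle_cat)

theorem adm_swap {a b c : S} (h : D.adm a b c = true) : D.adm b a c = true :=
  (D.adm_comm b a c).trans h

/-- The braiding. -/
def braidHom (X Y : Obj D) : tensorObj X Y ⟶ tensorObj Y X :=
  mkHom (fun p q => if (p.1.1 = q.1.2.1 ∧ p.1.2.1 = q.1.1) ∧ p.1.2.2 = q.1.2.2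
    then D.R (X.lab p.1.1) (Y.lab p.1.2.1) p.1.2.2 else 0) fun _ _ h => if_neg fun h' => h h'.2

/-- The inverse of the braiding. -/
def braidInv (X Y : Obj D) : tensorObj Y X ⟶ tensorObj X Y :=
  mkHom (fun q p => if (q.1.1 = p.1.2.1 ∧ q.1.2.1 = p.1.1) ∧ q.1.2.2 = p.1.2.2
    then (D.R (X.lab q.1.2.1) (Y.lab q.1.1) q.1.2.2)⁻¹ else 0) fun _ _ h => if_neg fun h' => h h'.2

theorem strip_braidHom (X Y : Obj D) {i j c h} (N : (tensorObj Y X).ι → k) :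
    ∑ y, entry (braidHom X Y) ⟨(i, j, c), h⟩ y * N y =
      D.R (X.lab i) (Y.lab j) c * N ⟨(j, i, c), adm_swap h⟩ := by
  rw [Fintype.sum_eq_single ⟨(j, i, c), adm_swap h⟩]
  · simp [braidHom]
  · rintro ⟨⟨j', i', c'⟩, h'⟩ hne
    rw [braidHom, entry_mkHom, if_neg, zero_mul]
    rintro ⟨⟨rfl, rfl⟩, rfl⟩
    exact hne rfl

theorem strip_braidInv (X Y : Obj D) {i j c h} (N : (tensorObj X Y).ι → k) :
    ∑ y, entry (braidInv X Y) ⟨(j, i, c), h⟩ y * N y =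
      (D.R (X.lab i) (Y.lab j) c)⁻¹ * N ⟨(i, j, c), adm_swap h⟩ := by
  rw [Fintype.sum_eq_single ⟨(i, j, c), adm_swap h⟩]
  · simp [braidInv]
  · rintro ⟨⟨j', i', c'⟩, h'⟩ hne
    rw [braidInv, entry_mkHom, if_neg, zero_mul]
    rintro ⟨⟨rfl, rfl⟩, rfl⟩
    exact hne rfl

theorem right_strip_braidHom (X Y : Obj D) {i j c h} (N : (tensorObj X Y).ι → k) :
    ∑ y, N y * entry (braidHom X Y) y ⟨(j, i, c), h⟩ =
      N ⟨(i, j, c), adm_swap h⟩ * D.R (X.lab i) (Y.lab j) c := by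
  rw [Fintype.sum_eq_single ⟨(i, j, c), adm_swap h⟩]
  · simp [braidHom]
  · rintro ⟨⟨j', i', c'⟩, h'⟩ hne
    rw [braidHom, entry_mkHom, if_neg, mul_zero]
    rintro ⟨⟨h1, h2⟩, h3⟩
    dsimp only at h1 h2 h3
    subst h1 h2 h3
    exact hne rfl

theorem braid_hom_inv (X Y : Obj D) : braidHom X Y ≫ braidInv X Y = 𝟙 _ := by
  refine hom_ext ?_
  rintro ⟨⟨i, j, c⟩, h⟩ ⟨⟨i', j', c'⟩, h'⟩
  rw [entry_comp, strip_braidHom]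
  simp only [braidInv, entry_mkHom, entry_id, mul_ite, mul_zero, mul_inv_cancel₀ (D.R_ne_zero _ _ _),
    Subtype.mk.injEq, Prod.mk.injEq, and_assoc, and_left_comm]

theorem braid_inv_hom (X Y : Obj D) : braidInv X Y ≫ braidHom X Y = 𝟙 _ := by
  refine hom_ext ?_
  rintro ⟨⟨i, j, c⟩, h⟩ ⟨⟨i', j', c'⟩, h'⟩
  rw [entry_comp, strip_braidInv]
  simp only [braidHom, entry_mkHom, entry_id, mul_ite, mul_zero, inv_mul_cancel₀ (D.R_ne_zero _ _ _),
    Subtype.mk.injEq, Prod.mk.injEq, and_assoc, and_left_comm]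

theorem braid_nat {X₁ X₂ Y₁ Y₂ : Obj D} (f : X₁ ⟶ Y₁) (g : X₂ ⟶ Y₂) :
    tensorHom f g ≫ braidHom Y₁ Y₂ = braidHom X₁ X₂ ≫ tensorHom g f := by
  refine hom_ext ?_
  rintro ⟨⟨i, j, c⟩, h⟩ ⟨⟨j', i', c'⟩, h'⟩
  rw [entry_comp, entry_comp, strip_braidHom, right_strip_braidHom]
  simp only [tensorHom, entry_mkHom]
  by_cases hc : c = c'
  · subst hc
    by_cases hi : X₁.lab i = Y₁.lab i'
    · by_cases hj : X₂.lab j = Y₂.lab j'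
      · simp only [if_true, hi, hj]
        ring
      · simp [entry_eq_zero _ hj]
    · simp [entry_eq_zero _ hi]
  · simp [hc]

theorem hexagon_forward_cat (X Y Z : Obj D) :
    assocHom X Y Z ≫ braidHom X (tensorObj Y Z) ≫ assocHom Y Z X =
      tensorHom (braidHom X Y) (𝟙 Z) ≫ assocHom Y X Z ≫ tensorHom (𝟙 Y) (braidHom X Z) := by
  refine hom_ext ?_
  rintro ⟨⟨⟨⟨i, j, e⟩, h1⟩, l, d⟩, h2⟩ ⟨⟨j', ⟨⟨l', i', g⟩, h1'⟩, d'⟩, h2'⟩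
  have key : ∀ f h1 h2, entry (braidHom X (tensorObj Y Z) ≫ assocHom Y Z X)
      ⟨(i, ⟨(j, l, f), h1⟩, d), h2⟩ ⟨(j', ⟨(l', i', g), h1'⟩, d'), h2'⟩ =
      D.R (X.lab i) f d * (if (j = j' ∧ l = l') ∧ (i = i' ∧ d = d') then
        D.F (Y.lab j) (Z.lab l) (X.lab i) d f g else 0) := by
    intro f h1 h2
    rw [entry_comp, strip_braidHom]
    simp only [assocHom, entry_mkHom]
  have key2 : ∀ h1 h2, entry (assocHom Y X Z ≫ tensorHom (𝟙 Y) (braidHom X Z))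
      ⟨(⟨(j, i, e), h1⟩, l, d), h2⟩ ⟨(j', ⟨(l', i', g), h1'⟩, d'), h2'⟩ =
      if (j = j' ∧ l = l') ∧ (i = i' ∧ d = d') then
        D.F (Y.lab j) (X.lab i) (Z.lab l) d e g * D.R (X.lab i) (Z.lab l) g else 0 := by
    intro h1 h2
    rw [entry_comp, strip_assocHom' (N' := fun f => if d = d' then (if j = j' then 1 else 0) *
      (if (i = i' ∧ l = l') ∧ f = g then D.R (X.lab i) (Z.lab l) f else 0) else 0)
      (hN := fun f h1 h2 => by simp only [tensorHom, braidHom, entry_mkHom, entry_id])]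
    by_cases hi : i = i' <;> by_cases hj : j = j' <;> by_cases hl : l = l' <;>
      by_cases hd : d = d' <;> simp [hi, hj, hl, hd]
  rw [entry_comp, entry_comp, strip_assocHom' (hN := key), strip_tensorHom_id, strip_braidHom,
    dif_pos h2, key2]
  by_cases hh : (j = j' ∧ l = l') ∧ (i = i' ∧ d = d')
  · simp only [if_pos hh, ← mul_assoc, D.hexagon_forward]
  · simp only [if_neg hh, mul_zero, Finset.sum_const_zero]

theorem hexagon_reverse_cat (X Y Z : Obj D) :
    assocInv X Y Z ≫ braidHom (tensorObj X Y) Z ≫ assocInv Z X Y =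
      tensorHom (𝟙 X) (braidHom Y Z) ≫ assocInv X Z Y ≫ tensorHom (braidHom X Z) (𝟙 Y) := by
  refine hom_ext ?_
  rintro ⟨⟨i, ⟨⟨j, l, f⟩, h1⟩, d⟩, h2⟩ ⟨⟨⟨⟨l', i', g⟩, h1'⟩, j', d'⟩, h2'⟩
  have key : ∀ e h1 h2, entry (braidHom (tensorObj X Y) Z ≫ assocInv Z X Y)
      ⟨(⟨(i, j, e), h1⟩, l, d), h2⟩ ⟨(⟨(l', i', g), h1'⟩, j', d'), h2'⟩ =
      D.R e (Z.lab l) d * (if (l = l' ∧ i = i') ∧ (j = j' ∧ d = d') then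
        D.G (Z.lab l) (X.lab i) (Y.lab j) d e g else 0) := by
    intro f h1 h2
    rw [entry_comp, strip_braidHom]
    simp only [assocInv, entry_mkHom]
    by_cases hh : (l = l' ∧ i = i') ∧ (j = j' ∧ d = d')
    · obtain ⟨⟨rfl, rfl⟩, rfl, rfl⟩ := hh
      rfl
    · rw [if_neg hh, if_neg hh]
  have key2 : ∀ h1 h2, entry (assocInv X Z Y ≫ tensorHom (braidHom X Z) (𝟙 Y))
      ⟨(i, ⟨(l, j, f), h1⟩, d), h2⟩ ⟨(⟨(l', i', g), h1'⟩, j', d'), h2'⟩ =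
      if (l = l' ∧ i = i') ∧ (j = j' ∧ d = d') then
        D.G (X.lab i) (Z.lab l) (Y.lab j) d f g * D.R (X.lab i) (Z.lab l) g else 0 := by
    intro h1 h2
    rw [entry_comp, strip_assocInv' (N' := fun f => if d = d' then
      (if (i = i' ∧ l = l') ∧ f = g then D.R (X.lab i) (Z.lab l) f else 0) *
        (if j = j' then 1 else 0) else 0)
      (hN := fun f h1 h2 => by simp only [tensorHom, braidHom, entry_mkHom, entry_id])]
    by_cases hi : i = i' <;> by_cases hj : j = j' <;> by_cases hl : l = l' <;>
      by_cases hd : d = d' <;> simp [hi, hj, hl, hd]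
  rw [entry_comp, entry_comp, strip_assocInv' (hN := key), strip_id_tensorHom, strip_braidHom,
    dif_pos h2, key2]
  by_cases hh : (l = l' ∧ i = i') ∧ (j = j' ∧ d = d')
  · simp only [if_pos hh, ← mul_assoc, D.hexagon_reverse]
  · simp only [if_neg hh, mul_zero, Finset.sum_const_zero]

instance : BraidedCategory (Obj D) where
  braiding X Y := ⟨braidHom X Y, braidInv X Y, braid_hom_inv X Y, braid_inv_hom X Y⟩
  braiding_naturality_right X _ _ f := braid_nat (𝟙 X) f
  braiding_naturality_left f Z := braid_nat f (𝟙 Z)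
  hexagon_forward := hexagon_forward_cat
  hexagon_reverse := hexagon_reverse_cat

/-- The ribbon twist: multiplication by `tw s` on each summand `s`. -/
def twist (X : Obj D) : X ≅ X where
  hom := mkHom (fun i j => if i = j then D.tw (X.lab i) else 0)
    fun i j h => if_neg fun h' => h (congrArg _ h')
  inv := mkHom (fun i j => if i = j then (D.tw (X.lab i))⁻¹ else 0)
    fun i j h => if_neg fun h' => h (congrArg _ h')
  hom_inv_id := hom_ext fun i j => by
    by_cases h : i = j
    · subst h; simp [entry_comp, entry_id, D.tw_ne_zero]
    · simp [entry_comp, entry_id, h]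
  inv_hom_id := hom_ext fun i j => by
    by_cases h : i = j
    · subst h; simp [entry_comp, entry_id, D.tw_ne_zero]
    · simp [entry_comp, entry_id, h]

theorem twist_nat {X Y : Obj D} (f : X ⟶ Y) : f ≫ (twist Y).hom = (twist X).hom ≫ f :=
  hom_ext fun i j => by
    by_cases h : X.lab i = Y.lab j
    · simp [entry_comp, twist, h, mul_comm]
    · simp [entry_comp, twist, entry_eq_zero f h]

theorem entry_comp_twist_id {W X Y : Obj D} (g : W ⟶ tensorObj X Y) (w : W.ι)
    (p : (tensorObj X Y).ι) :
    entry (g ≫ tensorHom (twist X).hom (𝟙 Y)) w p = entry g w p * D.tw (X.lab p.1.1) := by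
  rw [entry_comp, Fintype.sum_eq_single p]
  · simp [tensorHom, twist, entry_id]
  · intro q hq
    obtain ⟨⟨i, j, c⟩, h⟩ := p
    obtain ⟨⟨i', j', c'⟩, h'⟩ := q
    simp only [tensorHom, twist, entry_mkHom, entry_id]
    by_cases hi : i' = i <;> by_cases hj : j' = j <;> by_cases hc : c' = c <;> simp_all

theorem entry_comp_id_twist {W X Y : Obj D} (g : W ⟶ tensorObj X Y) (w : W.ι)
    (p : (tensorObj X Y).ι) :
    entry (g ≫ tensorHom (𝟙 X) (twist Y).hom) w p = entry g w p * D.tw (Y.lab p.1.2.1) := by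
  rw [entry_comp, Fintype.sum_eq_single p]
  · simp [tensorHom, twist, entry_id]
  · intro q hq
    obtain ⟨⟨i, j, c⟩, h⟩ := p
    obtain ⟨⟨i', j', c'⟩, h'⟩ := q
    simp only [tensorHom, twist, entry_mkHom, entry_id]
    by_cases hi : i' = i <;> by_cases hj : j' = j <;> by_cases hc : c' = c <;> simp_all

theorem twist_tensor (X Y : Obj D) : (twist (tensorObj X Y)).hom =
    tensorHom (twist X).hom (twist Y).hom ≫ braidHom X Y ≫ braidHom Y X := by
  refine hom_ext ?_
  rintro ⟨⟨i, j, c⟩, h⟩ ⟨⟨i', j', c'⟩, h'⟩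
  rw [← Category.assoc, entry_comp, right_strip_braidHom, entry_comp, right_strip_braidHom]
  simp only [twist, tensorHom, entry_mkHom]
  by_cases hi : i = i' <;> by_cases hj : j = j' <;> by_cases hc : c = c' <;> simp [hi, hj, hc]
  subst hi hj hc
  rw [D.balancing _ _ _ h]
  ring

theorem twist_coev {X Y : Obj D} (g : unitObj D ⟶ tensorObj X Y) :
    g ≫ tensorHom (twist X).hom (𝟙 Y) = g ≫ tensorHom (𝟙 X) (twist Y).hom := by
  refine hom_ext ?_
  rintro w ⟨⟨i, j, c⟩, h⟩
  rw [entry_comp_twist_id, entry_comp_id_twist]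
  by_cases hc : D.one = c
  · subst hc
    rw [D.tw_dual _ _ h]
  · rw [entry_eq_zero g hc, zero_mul, zero_mul]

end PremodularData

/-- A ribbon twist on a braided monoidal category: a natural automorphism `θ` of the identity functor
with `θ_{X ⊗ Y} = c_{Y,X} c_{X,Y} (θ_X ⊗ θ_Y)` and compatible with duals. -/
class RibbonTwist (C : Type*) [Category C] [MonoidalCategory C] [BraidedCategory C] where
  θ : ∀ X : C, X ≅ X
  naturality : ∀ {X Y : C} (f : X ⟶ Y), f ≫ (θ Y).hom = (θ X).hom ≫ f
  balancing : ∀ X Y : C, (θ (X ⊗ Y)).hom =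
    ((θ X).hom ⊗ₘ (θ Y).hom) ≫ (β_ X Y).hom ≫ (β_ Y X).hom
  dual : ∀ (X Y : C) [ExactPairing X Y],
    η_ X Y ≫ (θ X).hom ▷ Y = η_ X Y ≫ X ◁ (θ Y).hom

namespace PremodularData
variable {k : Type w} [Field k] {S : Type} [Fintype S] [DecidableEq S] {D : PremodularData k S}

instance : RibbonTwist (Obj D) where
  θ := twist
  naturality := twist_nat
  balancing := twist_tensor
  dual X Y _ := twist_coev (η_ X Y)

/-- The simple object with label `s`. -/
def simple (D : PremodularData k S) (s : S) : Obj D where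
  ι := Unit
  lab _ := s

/-- The class of an object in the Grothendieck group `K₀ = ℤ[S]`, the free abelian group on the
isomorphism classes of simple objects: each simple object is counted with its multiplicity. -/
noncomputable def K0Class (X : Obj D) : S →₀ ℤ := ∑ i, Finsupp.single (X.lab i) 1

theorem K0Class_apply (X : Obj D) (s : S) : K0Class X s = Fintype.card {i // X.lab i = s} := by
  simp [K0Class, Finsupp.single_apply, Fintype.card_subtype]

theorem K0Class_eq_of_iso {X Y : Obj D} (f : X ≅ Y) : K0Class X = K0Class Y := by
  have key : ∀ {X Y : Obj D} (g : X ⟶ Y) (h : Y ⟶ X) (_ : g ≫ h = 𝟙 X) (s : S),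
      (Matrix.of fun (i : {i // X.lab i = s}) (j : {j // Y.lab j = s}) => entry g i j) *
        (Matrix.of fun (i : {i // Y.lab i = s}) (j : {j // X.lab j = s}) => entry h i j) = 1 := by
    intro X Y g h hgh s
    ext ⟨i, hi⟩ ⟨j, hj⟩
    have h1 : entry (g ≫ h) i j = entry (𝟙 X) i j := by rw [hgh]
    rw [entry_comp, entry_id,
      ← Fintype.sum_subtype_add_sum_subtype (fun l => Y.lab l = s)] at h1
    rw [Finset.sum_eq_zero (s := Finset.univ (α := {l // ¬ Y.lab l = s}))
      (fun l _ => by rw [entry_eq_zero g (fun e => l.2 (e.symm.trans hi)), zero_mul]),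
      add_zero] at h1
    simpa [Matrix.mul_apply, Matrix.one_apply] using h1
  ext s
  rw [K0Class_apply, K0Class_apply]
  exact congrArg _ (Matrix.square_of_invertible _ _ (key f.hom f.inv f.hom_inv_id s)
    (key f.inv f.hom f.inv_hom_id s))

end PremodularData

namespace CategoryTheory.Mon
variable {C : Type*} [Category C] [MonoidalCategory C] [BraidedCategory C]

/-- The functional `ε : A → A ⊗ A ⊗ A* → A ⊗ A* → A* ⊗ A → 1` of an algebra `A` with dual `A*`, given by
coevaluation, multiplication, braiding and evaluation. -/
def traceForm (A : Mon C) (A' : C) [ExactPairing A.X A'] : A.X ⟶ 𝟙_ C :=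
  (ρ_ A.X).inv ≫ A.X ◁ η_ A.X A' ≫ (α_ A.X A.X A').inv ≫ MonObj.mul ▷ A' ≫
    (β_ A.X A').hom ≫ ε_ A.X A'

/-- An algebra is separable if the pairing `e = ε μ : A ⊗ A → 1` is non-degenerate: there is
`κ : 1 → A ⊗ A` such that `(e ⊗ 1)(1 ⊗ κ)` is the identity of `A`.
(A dual is unique up to unique isomorphism, and `ε` does not depend on its choice.) -/
def IsSeparable (A : Mon C) : Prop :=
  ∃ (A' : C) (_ : ExactPairing A.X A') (κ : 𝟙_ C ⟶ A.X ⊗ A.X),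
    (ρ_ A.X).inv ≫ A.X ◁ κ ≫ (α_ A.X A.X A.X).inv ≫
      (MonObj.mul ≫ traceForm A A') ▷ A.X ≫ (λ_ A.X).hom = 𝟙 A.X

/-- An algebra is ribbon if the twist is trivial on it, `θ_A = 1_A`. -/
def IsRibbon [RibbonTwist C] (A : Mon C) : Prop := (RibbonTwist.θ A.X).hom = 𝟙 A.X

/-- A non-zero algebra is simple if any non-zero homomorphism out of it is injective. -/
def IsSimple [Limits.HasZeroMorphisms C] (A : Mon C) : Prop :=
  ¬ Limits.IsZero A.X ∧ ∀ (B : Mon C) (f : A ⟶ B), f.hom ≠ 0 → Mono f.hom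

/-- A non-zero algebra is indecomposable if it is not the direct sum of two non-zero algebras. -/
def IsIndecomposable (A : Mon C) : Prop :=
  ¬ Limits.IsZero A.X ∧ ∀ (B₁ B₂ : Mon C) (p₁ : A ⟶ B₁) (p₂ : A ⟶ B₂),
    Nonempty (Limits.IsLimit (Limits.BinaryFan.mk p₁.hom p₂.hom)) →
      Limits.IsZero B₁.X ∨ Limits.IsZero B₂.X

end CategoryTheory.Mon

section FibProduct
variable {k : Type w} [Field k] {u v : k}

/-- The data of the Deligne product of `ℓ` copies of `Fib_u` and `m` copies of `Fib_v`. -/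
abbrev fibProductData (hu : IsPrimitiveRoot u 10) (hv : IsPrimitiveRoot v 10) (ℓ m : ℕ) :
    PremodularData k (Fin ℓ ⊕ Fin m → Bool) :=
  PremodularData.pi (Sum.elim (fun _ => fibData u hu) (fun _ => fibData v hv))

/-- The ribbon category `Fib_u^{⊠ℓ} ⊠ Fib_v^{⊠m}`. -/
abbrev FibProduct (hu : IsPrimitiveRoot u 10) (hv : IsPrimitiveRoot v 10) (ℓ m : ℕ) : Type 1 :=
  PremodularData.Obj (fibProductData hu hv ℓ m)

/-- The simple object `x_i` of `Fib_u^{⊠ℓ} ⊠ Fib_v^{⊠m}`: the non-trivial simple object in the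
`i`-th factor and the unit in all others. -/
def FibProduct.x (hu : IsPrimitiveRoot u 10) (hv : IsPrimitiveRoot v 10) (ℓ m : ℕ)
    (i : Fin ℓ ⊕ Fin m) : FibProduct hu hv ℓ m :=
  PremodularData.simple _ fun j => decide (j = i)

end FibProduct

/-! Part (1). An indecomposable separable commutative algebra `A` is connected: every morphism from
the unit object to `A` is a multiple of the unit `η` of `A` (`Mon.exists_eq_smul_one`). The bimodule
endomorphisms of `A` form a finite-dimensional commutative algebra. It is reduced, because a
square-zero element has trace zero against everything and the trace pairing is non-degenerate; it
has no non-trivial idempotents, because one would split `A`. Over an algebraically closed field it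
is therefore the field of scalars, and multiplication by an element of `A` is such an endomorphism.

A simple object of the product is a subset `s` of the set of factors. The ribbon condition says that
the twist, the product of `w i ^ (-2)` over `s`, is 1 for every summand of `A`. This excludes
subsets of size one, since `w a ^ 2 ≠ 1`, and of size two, since `w a * w b` is a fifth root of
unity different from 1.

Larger subsets are excluded by induction on inclusion (`lab_eq_one_of_isRibbon`). If only 1 and `s`
can occur in `A` among the subsets of `s`, take three summands of type `s` and compare `(xx)x` with
`x(xx)` through an intermediate channel `e` absent from `A`. The left side vanishes, leaving one
linear relation between two unknowns: the pairing of `s` with itself and a product along `s`. The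
channels `{a}` and `{a, b}` give two such relations with coefficient ratios `α_a` and `α_a * α_b`.
These differ because `α_b ≠ 1`, so the pairing vanishes, against non-degeneracy
(`Mon.lab_ne_of_associativity`). A connected algebra with only unit summands is the unit algebra
(`Mon.nonempty_iso_trivial`).

Part (2). The parameters `u` and `u⁻¹` give the same `α` and inverse braidings, so on `1 ⊕ x₁x₂` the
braiding is trivial and explicit structure constants define a commutative algebra. It is separable
because its dimension `1 + α⁻²` is non-zero, and simple because each summand multiplies with itself
non-trivially into the unit (`isSeparable_of_diag`, `isSimple_of_diag`). -/

open scoped CategoryTheory.MonObj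

/-! ### Reduced finite-dimensional algebras without idempotents -/

/-- A reduced finite-dimensional commutative algebra over an algebraically closed field without
non-trivial idempotents is the field itself. -/
theorem algebraMap_surjective_of_isIdempotentElem {k R : Type*} [Field k] [IsAlgClosed k]
    [CommRing R] [Nontrivial R] [Algebra k R] [Module.Finite k R]
    (hred : ∀ x : R, x ^ 2 = 0 → x = 0) (hidem : ∀ e : R, e * e = e → e = 0 ∨ e = 1) :
    Function.Surjective (algebraMap k R) := by
  have hred' : IsReduced R := by
    rw [isReduced_iff_pow_one_lt 2 (by norm_num)]
    exact hred
  have : IsArtinianRing R := IsArtinianRing.of_finite k R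
  have hfield : IsField R := by
    refine ⟨exists_pair_ne R, mul_comm, fun {x} hx => ?_⟩
    -- The ideals generated by powers of `x` stabilise, so `x ^ (n + 1) * y = x ^ n`. Then `x * (1 -
    -- y * x)` is nilpotent, hence zero, and `y * x` is an idempotent, equal to 0 only if `x = 0`.
    obtain ⟨n, y, hy⟩ := IsArtinian.exists_pow_succ_smul_dvd x (1 : R)
    simp only [smul_eq_mul, mul_one, Nat.succ_eq_add_one] at hy
    have h0 : (x - y * x ^ 2) ^ (n + 1) = 0 := by
      have : x - y * x ^ 2 = x * (1 - y * x) := by ring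
      rw [this, mul_pow, pow_succ (1 - y * x)]
      have h2 : x ^ (n + 1) * (1 - y * x) = x * (x ^ n - x ^ (n + 1) * y) := by ring
      calc _ = (x ^ (n + 1) * (1 - y * x)) * (1 - y * x) ^ n := by ring
        _ = 0 := by rw [h2, ← hy]; ring
    have h1 : x = y * x ^ 2 := sub_eq_zero.1 (pow_eq_zero_iff (Nat.succ_ne_zero n) |>.1 h0)
    rcases hidem (y * x) (by linear_combination -y * h1) with h | h
    · exact absurd (by linear_combination h1 + x * h) hx
    · exact ⟨y, by rw [mul_comm, h]⟩
  have : IsDomain R := hfield.isDomain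
  exact (IsAlgClosed.algebraMap_bijective_of_isIntegral).2


/-! ### Bimodule endomorphisms of an algebra and the splitting of idempotents -/

namespace CategoryTheory.Mon
variable {C : Type*} [Category C] [MonoidalCategory C]

/-- An endomorphism of the underlying object of an algebra which is a map of bimodules. -/
structure IsBimoduleEnd (A : Mon C) (f : A.X ⟶ A.X) : Prop where
  left : μ[A.X] ≫ f = f ▷ A.X ≫ μ[A.X]
  right : μ[A.X] ≫ f = A.X ◁ f ≫ μ[A.X]

section Splitting
variable (A : Mon C) {B : C} (r : A.X ⟶ B) (s : B ⟶ A.X)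

/-- The algebra structure on the image of an idempotent bimodule endomorphism. -/
@[simps X]
def ofSplitting (hsr : s ≫ r = 𝟙 B) (h : A.IsBimoduleEnd (r ≫ s)) : Mon C :=
  -- `h1` and `h2` express that the kernel of `r` is a two-sided ideal: projecting either factor
  -- beforehand does not change the projected product. Unit and associativity laws then descend from
  -- `A`.
  have h1 : (r ≫ s) ▷ A.X ≫ μ[A.X] ≫ r = μ[A.X] ≫ r := by
    simpa [hsr] using (h.left =≫ r).symm
  have h2 : A.X ◁ (r ≫ s) ≫ μ[A.X] ≫ r = μ[A.X] ≫ r := by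
    simpa [hsr] using (h.right =≫ r).symm
  { X := B
    mon :=
    { one := η[A.X] ≫ r
      mul := (s ⊗ₘ s) ≫ μ[A.X] ≫ r
      one_mul := by
        have : (η[A.X] ≫ r) ▷ B ≫ (s ⊗ₘ s) = 𝟙_ C ◁ s ≫ η[A.X] ▷ A.X ≫ (r ≫ s) ▷ A.X := by
          simp only [← tensorHom_id, ← id_tensorHom, tensorHom_comp_tensorHom, Category.assoc,
            Category.comp_id, Category.id_comp]
        rw [reassoc_of% this, h1]
        simp [hsr]
      mul_one := by
        have : B ◁ (η[A.X] ≫ r) ≫ (s ⊗ₘ s) = s ▷ 𝟙_ C ≫ A.X ◁ η[A.X] ≫ A.X ◁ (r ≫ s) := by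
          simp only [← tensorHom_id, ← id_tensorHom, tensorHom_comp_tensorHom, Category.assoc,
            Category.comp_id, Category.id_comp]
        rw [reassoc_of% this, h2]
        simp [hsr]
      mul_assoc := by
        have e1 : ((s ⊗ₘ s) ≫ μ[A.X] ≫ r) ▷ B ≫ (s ⊗ₘ s) =
            ((s ⊗ₘ s) ⊗ₘ s) ≫ μ[A.X] ▷ A.X ≫ (r ≫ s) ▷ A.X := by
          simp only [← tensorHom_id, tensorHom_comp_tensorHom, Category.assoc, Category.comp_id,
            Category.id_comp]
        have e2 : B ◁ ((s ⊗ₘ s) ≫ μ[A.X] ≫ r) ≫ (s ⊗ₘ s) =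
            (s ⊗ₘ (s ⊗ₘ s)) ≫ A.X ◁ μ[A.X] ≫ A.X ◁ (r ≫ s) := by
          simp only [← id_tensorHom, tensorHom_comp_tensorHom, Category.assoc, Category.comp_id,
            Category.id_comp]
        rw [reassoc_of% e1, h1, reassoc_of% e2, h2, MonObj.mul_assoc_assoc,
          associator_naturality_assoc] } }

/-- The projection onto the image of an idempotent bimodule endomorphism. -/
@[simps hom]
def toSplitting (hsr : s ≫ r = 𝟙 B) (h : A.IsBimoduleEnd (r ≫ s)) :
    A ⟶ A.ofSplitting r s hsr h where
  hom := r
  isMonHom_hom :=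
    { one_hom := rfl
      mul_hom := by
        have h1 : (r ≫ s) ▷ A.X ≫ μ[A.X] ≫ r = μ[A.X] ≫ r := by
          simpa [hsr] using (h.left =≫ r).symm
        have h2 : A.X ◁ (r ≫ s) ≫ μ[A.X] ≫ r = μ[A.X] ≫ r := by
          simpa [hsr] using (h.right =≫ r).symm
        change μ[A.X] ≫ r = (r ⊗ₘ r) ≫ (s ⊗ₘ s) ≫ μ[A.X] ≫ r
        rw [tensorHom_comp_tensorHom_assoc, MonoidalCategory.tensorHom_def, Category.assoc, h2, h1] }

end Splitting

namespace IsBimoduleEnd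
variable {A : Mon C} {f g : A.X ⟶ A.X}

theorem id : A.IsBimoduleEnd (𝟙 A.X) := ⟨by simp, by simp⟩

theorem comp (hf : A.IsBimoduleEnd f) (hg : A.IsBimoduleEnd g) : A.IsBimoduleEnd (f ≫ g) :=
  ⟨by rw [← Category.assoc, hf.left, Category.assoc, hg.left, comp_whiskerRight, Category.assoc],
    by rw [← Category.assoc, hf.right, Category.assoc, hg.right, whiskerLeft_comp, Category.assoc]⟩

/-- Multiplication by an element from the left commutes with right module endomorphisms. -/
theorem comp_mulLeft (hf : A.IsBimoduleEnd f) (x : 𝟙_ C ⟶ A.X) :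
    f ≫ (λ_ A.X).inv ≫ x ▷ A.X ≫ μ[A.X] = ((λ_ A.X).inv ≫ x ▷ A.X ≫ μ[A.X]) ≫ f := by
  simp only [Category.assoc, hf.right]
  rw [← whisker_exchange_assoc, ← leftUnitor_inv_naturality_assoc]

theorem mulLeft_one_comp (hf : A.IsBimoduleEnd f) :
    (λ_ A.X).inv ≫ (η[A.X] ≫ f) ▷ A.X ≫ μ[A.X] = f := by
  rw [comp_whiskerRight, Category.assoc, ← hf.left, MonObj.one_mul_assoc, Iso.inv_hom_id_assoc]

/-- A bimodule endomorphism is left multiplication by its value at the unit, and right linearity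
lets any other one pass through a left multiplication. -/
theorem comp_comm (hf : A.IsBimoduleEnd f) (hg : A.IsBimoduleEnd g) : f ≫ g = g ≫ f := by
  conv_lhs => rw [← hg.mulLeft_one_comp, hf.comp_mulLeft, hg.mulLeft_one_comp]

variable [BraidedCategory C]

/-- The left condition is associativity, `x(ab) = (xa)b`; the right one follows from it by braiding
the two factors, which the commutative product does not see. -/
theorem mulLeft [IsCommMonObj A.X] (x : 𝟙_ C ⟶ A.X) :
    A.IsBimoduleEnd ((λ_ A.X).inv ≫ x ▷ A.X ≫ μ[A.X]) := by
  have hl : μ[A.X] ≫ ((λ_ A.X).inv ≫ x ▷ A.X ≫ μ[A.X]) =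
      ((λ_ A.X).inv ≫ x ▷ A.X ≫ μ[A.X]) ▷ A.X ≫ μ[A.X] := by
    rw [leftUnitor_inv_naturality_assoc, whisker_exchange_assoc, MonObj.mul_assoc_flip]
    simp
  refine ⟨hl, ?_⟩
  have h := (β_ A.X A.X).hom ≫= hl
  rw [← Category.assoc, IsCommMonObj.mul_comm, ← BraidedCategory.braiding_naturality_right_assoc,
    IsCommMonObj.mul_comm] at h
  exact h

end IsBimoduleEnd

/-! ### The trace form as a loop -/

section Trace
variable [BraidedCategory C]

/-- Cyclicity of the loop trace: `g` slides through the coevaluation onto the dual as its mate,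
through the braiding by naturality, and back through the evaluation, arriving on the other side of
`f`. -/
theorem coevaluation_braiding_evaluation_comm {X X' : C} [ExactPairing X X'] (f g : X ⟶ X) :
    η_ X X' ≫ (f ≫ g) ▷ X' ≫ (β_ X X').hom ≫ ε_ X X' =
      η_ X X' ≫ (g ≫ f) ▷ X' ≫ (β_ X X').hom ≫ ε_ X X' := by
  let : HasRightDual X := ⟨X'⟩
  have h1 := coevaluation_comp_rightAdjointMate_assoc g
    (h := f ▷ X' ≫ (β_ X X').hom ≫ ε_ X X')
  have h2 := rightAdjointMate_comp_evaluation g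
  change η_ X X' ≫ X ◁ (rightAdjointMate g : X' ⟶ X') ≫ _ = η_ X X' ≫ g ▷ X' ≫ _ at h1
  change (rightAdjointMate g : X' ⟶ X') ▷ X ≫ ε_ X X' = X' ◁ g ≫ ε_ X X' at h2
  rw [comp_whiskerRight, comp_whiskerRight, Category.assoc, Category.assoc, ← h1,
    BraidedCategory.braiding_naturality_left_assoc, ← h2,
    ← BraidedCategory.braiding_naturality_right_assoc, ← whisker_exchange_assoc]
  rfl

/-- The value of the trace form on `x` is the loop trace of multiplication by `x`; in this form
cyclicity applies to it. -/
theorem comp_traceForm (A : Mon C) (A' : C) [ExactPairing A.X A'] (x : 𝟙_ C ⟶ A.X) :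
    x ≫ A.traceForm A' = η_ A.X A' ≫ ((λ_ A.X).inv ≫ x ▷ A.X ≫ μ[A.X]) ▷ A' ≫
      (β_ A.X A').hom ≫ ε_ A.X A' := by
  have h : x ≫ (ρ_ A.X).inv ≫ A.X ◁ η_ A.X A' ≫ (α_ A.X A.X A').inv =
      η_ A.X A' ≫ ((λ_ A.X).inv ≫ x ▷ A.X) ▷ A' := by
    rw [rightUnitor_inv_naturality_assoc, ← whisker_exchange_assoc]
    simp only [comp_whiskerRight, leftUnitor_inv_whiskerRight,
      Category.assoc]
    simp [unitors_equal]
  simp only [traceForm, reassoc_of% h, comp_whiskerRight, Category.assoc]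

end Trace

end CategoryTheory.Mon

/-! ### Linearity and semisimplicity of the category of formal direct sums -/

namespace PremodularData
variable {k : Type w} [Field k] {S : Type} [Fintype S] [DecidableEq S] {D : PremodularData k S}

@[simp] theorem entry_add {X Y : Obj D} (f g : X ⟶ Y) (i : X.ι) (j : Y.ι) :
    entry (f + g) i j = entry f i j + entry g i j := rfl

@[simp] theorem entry_smul {X Y : Obj D} (c : k) (f : X ⟶ Y) (i : X.ι) (j : Y.ι) :
    entry (c • f) i j = c * entry f i j := rfl

@[simp] theorem entry_zero {X Y : Obj D} (i : X.ι) (j : Y.ι) : entry (0 : X ⟶ Y) i j = 0 := rfl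

theorem entry_whiskerRight {X Y : Obj D} (f : X ⟶ Y) (Z : Obj D) (p : (X ⊗ Z).ι) (q : (Y ⊗ Z).ι) :
    entry (f ▷ Z) p q = if p.1.2.2 = q.1.2.2 then
      entry f p.1.1 q.1.1 * (if p.1.2.1 = q.1.2.1 then 1 else 0) else 0 := by
  rw [← entry_id]
  rfl

theorem entry_whiskerLeft {X Y : Obj D} (Z : Obj D) (f : X ⟶ Y) (p : (Z ⊗ X).ι) (q : (Z ⊗ Y).ι) :
    entry (Z ◁ f) p q = if p.1.2.2 = q.1.2.2 then
      (if p.1.1 = q.1.1 then 1 else 0) * entry f p.1.2.1 q.1.2.1 else 0 := by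
  rw [← entry_id]
  rfl

instance : MonoidalPreadditive (Obj D) where
  whiskerLeft_zero := hom_ext fun p q => by simp [entry_whiskerLeft]
  zero_whiskerRight := hom_ext fun p q => by simp [entry_whiskerRight]
  whiskerLeft_add f g := hom_ext fun p q => by
    simp only [entry_whiskerLeft, entry_add]
    split_ifs <;> simp
  add_whiskerRight f g := hom_ext fun p q => by
    simp only [entry_whiskerRight, entry_add]
    split_ifs <;> simp

instance : MonoidalLinear k (Obj D) where
  whiskerLeft_smul X _ _ c f := hom_ext fun p q => by
    simp only [entry_whiskerLeft, entry_smul]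
    split_ifs <;> simp
  smul_whiskerRight c _ _ f X := hom_ext fun p q => by
    simp only [entry_whiskerRight, entry_smul]
    split_ifs <;> simp

instance (X Y : Obj D) : Module.Finite k (X ⟶ Y) :=
  inferInstanceAs (Module.Finite k (homSpace X Y))

/-- Idempotents split: the image is the sum of the summands indexing a basis of the row space. -/
theorem exists_splitting {X : Obj D} (e : X ⟶ X) (he : e ≫ e = e) :
    ∃ (B : Obj D) (r : X ⟶ B) (s : B ⟶ X), r ≫ s = e ∧ s ≫ r = 𝟙 B := by
  classical
  obtain ⟨κ, a, ha, hspan, hli⟩ := exists_linearIndependent' k (fun i j => entry e i j)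
  have : Fintype κ := Fintype.ofInjective a ha
  have hP : ∀ i, ∃ c : κ → k, ∑ j, c j • (fun l => entry e (a j) l) = fun l => entry e i l := by
    intro i
    refine (Submodule.mem_span_range_iff_exists_fun k).1 ?_
    change _ ∈ Submodule.span k (Set.range ((fun i j => entry e i j) ∘ a))
    rw [hspan]
    exact Submodule.subset_span ⟨i, rfl⟩
  choose P hP using hP
  let B : Obj D := ⟨κ, fun j => X.lab (a j)⟩
  let s : B ⟶ X := mkHom (fun j l => entry e (a j) l) fun j l h => entry_eq_zero e h
  -- Expansion coefficients between different labels need not vanish, but cutting them off is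
  -- harmless: row `a j` of `e` is supported on the label of `a j`, so they do not contribute to any
  -- permitted entry.
  let r : X ⟶ B := mkHom (fun i j => if X.lab i = X.lab (a j) then P i j else 0)
    fun i j h => if_neg h
  have hrs : r ≫ s = e := by
    refine hom_ext fun i l => ?_
    rw [entry_comp]
    simp only [r, s, entry_mkHom]
    by_cases hil : X.lab i = X.lab l
    · rw [← congrFun (hP i) l, Finset.sum_apply]
      refine Finset.sum_congr rfl fun j _ => ?_
      by_cases hij : X.lab i = X.lab (a j)
      · simp [hij]
      · simp [entry_eq_zero e (fun h => hij (hil.trans h.symm) : X.lab (a j) ≠ X.lab l)]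
    · rw [entry_eq_zero e hil]
      refine Finset.sum_eq_zero fun j _ => ?_
      by_cases hij : X.lab i = X.lab (a j)
      · rw [entry_eq_zero e (fun h => hil (hij.trans h) : X.lab (a j) ≠ X.lab l), mul_zero]
      · simp [hij]
  refine ⟨B, r, s, hrs, ?_⟩
  have hs : s ≫ e = s := hom_ext fun j l => by
    rw [entry_comp]
    exact (entry_comp e e (a j) l).symm.trans (by rw [he]; rfl)
  refine hom_ext fun j m => ?_
  -- The rows of `s` are linearly independent, so `s` can be cancelled on the right.
  have h0 : (s ≫ r - 𝟙 B) ≫ s = 0 := by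
    rw [Preadditive.sub_comp, Category.assoc, hrs, hs, Category.id_comp, sub_self]
  have h1 := Fintype.linearIndependent_iff.1 hli (fun m => entry (s ≫ r - 𝟙 B) j m) (by
    funext l
    have := congrArg (fun f => entry f j l) h0
    simp only [entry_comp] at this
    simpa [s] using this) m
  have h2 : s ≫ r = (s ≫ r - 𝟙 B) + 𝟙 B := by abel
  rw [h2, entry_add, h1, zero_add]

/-- The category is von Neumann regular. -/
theorem exists_comp_comp_eq {X Y : Obj D} (h : X ⟶ Y) : ∃ g : Y ⟶ X, h ≫ g ≫ h = h := by
  let f := Matrix.toLin' h.1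
  obtain ⟨g₀, hg₀⟩ := f.rangeRestrict.exists_rightInverse_of_surjective f.range_rangeRestrict
  obtain ⟨g, hg⟩ := LinearMap.exists_extend g₀
  have hfgf : f ∘ₗ g ∘ₗ f = f := by
    refine LinearMap.ext fun v => ?_
    have h1 : g (f v) = g₀ (f.rangeRestrict v) := LinearMap.congr_fun hg (f.rangeRestrict v)
    have h2 := LinearMap.congr_fun hg₀ (f.rangeRestrict v)
    simpa [h1] using congrArg Subtype.val h2
  have hM : h.1 * (LinearMap.toMatrix' g * h.1) = h.1 := by
    apply Matrix.toLin'.injective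
    rw [Matrix.toLin'_mul, Matrix.toLin'_mul, Matrix.toLin'_toMatrix']
    exact hfgf
  -- The generalised inverse from linear algebra mixes labels. Its label-preserving part does as
  -- well, because multiplying by `h` on both sides only sees those entries where `h` preserves
  -- labels.
  refine ⟨mkHom (fun j i => if Y.lab j = X.lab i then LinearMap.toMatrix' g j i else 0)
    fun j i hji => if_neg hji, hom_ext fun i j => ?_⟩
  by_cases hij : X.lab i = Y.lab j
  · have h3 := congrFun (congrFun hM i) j
    simp only [Matrix.mul_apply] at h3
    refine Eq.trans ?_ h3
    simp only [entry_comp, entry_mkHom]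
    refine Finset.sum_congr rfl fun l _ => ?_
    by_cases hl : X.lab i = Y.lab l
    · refine congrArg _ (Finset.sum_congr rfl fun m _ => ?_)
      by_cases hm : X.lab m = Y.lab j
      · rw [if_pos (hl.symm.trans (hij.trans hm.symm))]
        rfl
      · rw [entry_eq_zero h hm, mul_zero, h.2 _ _ hm, mul_zero]
    · rw [entry_eq_zero h hl, h.2 _ _ hl, zero_mul, zero_mul]
  · rw [entry_eq_zero h hij, entry_eq_zero _ hij]

/-- A square-zero endomorphism is annihilated by every functional with `t (f g) = t (g f)`. -/
theorem cyclic_apply_eq_zero {X : Obj D} {M : Type*} [AddCommGroup M] (t : (X ⟶ X) → M)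
    (h0 : t 0 = 0) (ht : ∀ f g, t (f ≫ g) = t (g ≫ f)) (h : X ⟶ X) (hh : h ≫ h = 0) : t h = 0 := by
  obtain ⟨g, hg⟩ := exists_comp_comp_eq h
  -- With `h = h g h`, cyclicity brings the two outer copies of `h` together.
  rw [← hg, ht, Category.assoc, hh, Limits.comp_zero, h0]

/-- By Schur's lemma a functional lives on the unit summands, and their inclusions detect it. -/
theorem comp_eq_zero_of_forall_unit {X : Obj D} (f : X ⟶ 𝟙_ (Obj D))
    (h : ∀ x : 𝟙_ (Obj D) ⟶ X, x ≫ f = 0) : f = 0 := by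
  refine hom_ext fun i j => ?_
  by_cases hi : X.lab i = D.one
  · have := congrArg (fun g => entry g () j) (h (mkHom (fun _ l => if i = l then 1 else 0)
      fun _ l hl => if_neg fun hil => hl (hi.symm.trans (congrArg _ hil))))
    simpa [entry_comp] using this
  · exact entry_eq_zero f hi

end PremodularData

/-! ### Indecomposable separable commutative algebras are connected -/

namespace CategoryTheory.Mon
open PremodularData
variable {k : Type w} [Field k] {S : Type} [Fintype S] [DecidableEq S] {D : PremodularData k S}

/-- Non-degeneracy in usable form: the zigzag with `κ` recovers `f` from its pairing with `A`. -/
theorem eq_zero_of_whiskerRight_comp_traceForm {A : Mon (Obj D)} {A' : Obj D}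
    [ExactPairing A.X A'] {κ : 𝟙_ (Obj D) ⟶ A.X ⊗ A.X}
    (hκ : (ρ_ A.X).inv ≫ A.X ◁ κ ≫ (α_ A.X A.X A.X).inv ≫
      (μ[A.X] ≫ A.traceForm A') ▷ A.X ≫ (λ_ A.X).hom = 𝟙 A.X)
    {X : Obj D} {f : X ⟶ A.X} (hf : f ▷ A.X ≫ μ[A.X] ≫ A.traceForm A' = 0) : f = 0 := by
  rw [← Category.comp_id f, ← hκ, rightUnitor_inv_naturality_assoc, ← whisker_exchange_assoc,
    associator_inv_naturality_left_assoc, ← comp_whiskerRight_assoc, hf]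
  simp

/-- The trace form at `f(x)` is the trace of multiplication by `f(x)`, which is multiplication by
`x` followed by `f`. These two commute, so the composite squares to zero and has trace zero. Thus
the trace form kills the image of `f`; since that image is an ideal, it pairs to zero with all of
`A`. -/
theorem IsBimoduleEnd.eq_zero_of_comp_self {A : Mon (Obj D)} [IsCommMonObj A.X]
    (hA : A.IsSeparable) {f : A.X ⟶ A.X} (hf : A.IsBimoduleEnd f) (hff : f ≫ f = 0) : f = 0 := by
  obtain ⟨A', _, κ, hκ⟩ := hA
  have h1 : f ≫ A.traceForm A' = 0 := by
    refine comp_eq_zero_of_forall_unit _ fun x => ?_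
    rw [← Category.assoc, comp_traceForm]
    refine cyclic_apply_eq_zero (fun h => η_ A.X A' ≫ h ▷ A' ≫ (β_ A.X A').hom ≫ ε_ A.X A')
      (by simp) (fun g h => coevaluation_braiding_evaluation_comm g h) _ ?_
    have hc := hf.comp_mulLeft x
    have hL : (λ_ A.X).inv ≫ (x ≫ f) ▷ A.X ≫ μ[A.X] = ((λ_ A.X).inv ≫ x ▷ A.X ≫ μ[A.X]) ≫ f := by
      rw [comp_whiskerRight, Category.assoc, ← hf.left, Category.assoc, Category.assoc]
    rw [hL]
    generalize (λ_ A.X).inv ≫ x ▷ A.X ≫ μ[A.X] = L at hc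
    rw [Category.assoc, ← Category.assoc f L f, hc, Category.assoc L f f, hff]
    simp
  refine eq_zero_of_whiskerRight_comp_traceForm hκ ?_
  rw [← Category.assoc, ← hf.left, Category.assoc, h1, Limits.comp_zero]

theorem IsBimoduleEnd.add {A : Mon (Obj D)} {f g : A.X ⟶ A.X} (hf : A.IsBimoduleEnd f)
    (hg : A.IsBimoduleEnd g) : A.IsBimoduleEnd (f + g) :=
  ⟨by simp [hf.left, hg.left], by simp [hf.right, hg.right]⟩

theorem IsBimoduleEnd.smul {A : Mon (Obj D)} {f : A.X ⟶ A.X} (c : k) (hf : A.IsBimoduleEnd f) :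
    A.IsBimoduleEnd (c • f) :=
  ⟨by simp [hf.left], by simp [hf.right]⟩

/-- The images of `e` and `1 - e` are algebras whose product is `A`, so indecomposability makes one
of them zero. -/
theorem IsBimoduleEnd.eq_zero_or_eq_id {A : Mon (Obj D)} (hA : A.IsIndecomposable)
    {e : A.X ⟶ A.X} (he : A.IsBimoduleEnd e) (hee : e ≫ e = e) : e = 0 ∨ e = 𝟙 A.X := by
  have he' : A.IsBimoduleEnd (𝟙 A.X - e) := by
    simpa [sub_eq_add_neg] using IsBimoduleEnd.id.add (he.smul (-1 : k))
  obtain ⟨B₁, r₁, s₁, h₁, h₁'⟩ := exists_splitting e hee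
  obtain ⟨B₂, r₂, s₂, h₂, h₂'⟩ := exists_splitting (𝟙 A.X - e) (by simp [hee])
  have h12 : s₁ ≫ r₂ = 0 := by
    have : s₁ ≫ r₂ = s₁ ≫ (r₁ ≫ s₁) ≫ (r₂ ≫ s₂) ≫ r₂ := by
      simp only [Category.assoc, h₂', Category.comp_id, reassoc_of% h₁']
    rw [this, h₁, h₂, ← Category.assoc e]
    simp [hee]
  have h21 : s₂ ≫ r₁ = 0 := by
    have : s₂ ≫ r₁ = s₂ ≫ (r₂ ≫ s₂) ≫ (r₁ ≫ s₁) ≫ r₁ := by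
      simp only [Category.assoc, h₁', Category.comp_id, reassoc_of% h₂']
    rw [this, h₁, h₂, ← Category.assoc (𝟙 A.X - e)]
    simp [hee]
  have hlim : Limits.IsLimit (Limits.BinaryFan.mk r₁ r₂) :=
    Limits.BinaryFan.IsLimit.mk _ (fun f g => f ≫ s₁ + g ≫ s₂)
      (fun f g => by simp [h₁', h21]) (fun f g => by simp [h12, h₂'])
      (fun f g m hf hg => by
        dsimp at hf hg
        rw [← hf, ← hg, Category.assoc, Category.assoc, h₁, h₂]
        simp)
  rcases hA.2 (A.ofSplitting r₁ s₁ h₁' (h₁.symm ▸ he)) (A.ofSplitting r₂ s₂ h₂' (h₂.symm ▸ he'))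
    (A.toSplitting r₁ s₁ h₁' (h₁.symm ▸ he)) (A.toSplitting r₂ s₂ h₂' (h₂.symm ▸ he')) ⟨hlim⟩
    with h | h
  · left
    have h0 : r₁ = 0 := h.eq_of_tgt r₁ 0
    rw [← h₁, h0, Limits.zero_comp]
  · right
    have h0 : r₂ = 0 := h.eq_of_tgt r₂ 0
    rw [h0, Limits.zero_comp] at h₂
    exact (sub_eq_zero.1 h₂.symm).symm

/-- The bimodule endomorphisms of an algebra. -/
def bimoduleEnd (A : Mon (Obj D)) : Subalgebra k (End A.X) where
  carrier := {f | A.IsBimoduleEnd f}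
  mul_mem' hf hg := hg.comp hf
  add_mem' hf hg := hf.add hg
  algebraMap_mem' c := by
    rw [Algebra.algebraMap_eq_smul_one]
    exact IsBimoduleEnd.id.smul c

/-- An indecomposable separable commutative algebra is connected: `Hom(1, A)` is spanned by the
unit. -/
theorem exists_eq_smul_one [IsAlgClosed k] {A : Mon (Obj D)} [IsCommMonObj A.X]
    (hsep : A.IsSeparable) (hind : A.IsIndecomposable) (x : 𝟙_ (Obj D) ⟶ A.X) :
    ∃ c : k, x = c • η[A.X] := by
  let _ : CommRing A.bimoduleEnd :=
    { (inferInstance : Ring A.bimoduleEnd) with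
      mul_comm := fun f g => Subtype.ext (g.2.comp_comm f.2) }
  have : Module.Finite k (End A.X) := inferInstanceAs (Module.Finite k (A.X ⟶ A.X))
  have : Nontrivial A.bimoduleEnd := ⟨1, 0, fun h => hind.1
    ((Limits.IsZero.iff_id_eq_zero _).2 (congrArg Subtype.val h))⟩
  obtain ⟨c, hc⟩ := algebraMap_surjective_of_isIdempotentElem (k := k) (R := A.bimoduleEnd)
    (fun f hf => Subtype.ext (f.2.eq_zero_of_comp_self hsep
      ((congrArg Subtype.val (pow_two f).symm).trans (congrArg Subtype.val hf))))
    (fun e he => (IsBimoduleEnd.eq_zero_or_eq_id hind e.2 (congrArg Subtype.val he)).imp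
      (fun h => Subtype.ext h) fun h => Subtype.ext h) ⟨_, IsBimoduleEnd.mulLeft x⟩
  refine ⟨c, ?_⟩
  have h1 : (λ_ A.X).inv ≫ x ▷ A.X ≫ μ[A.X] = c • 𝟙 A.X := by
    exact (congrArg Subtype.val hc).symm.trans (Algebra.algebraMap_eq_smul_one c)
  have h2 := η[A.X] ≫= h1
  -- Multiplication by `x` equals the scalar `c`; evaluated at the unit of `A`, this becomes `x = c
  -- • η`.
  rw [leftUnitor_inv_naturality_assoc, whisker_exchange_assoc, MonObj.mul_one] at h2
  simpa [unitors_inv_equal] using h2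

end CategoryTheory.Mon

/-! ### Associativity in coordinates, and which simple objects a connected algebra contains -/

namespace CategoryTheory.Mon
open PremodularData
variable {k : Type w} [Field k] {S : Type} [Fintype S] [DecidableEq S] {D : PremodularData k S}

theorem IsRibbon.tw_lab {A : Mon (Obj D)} (hA : A.IsRibbon) (i : A.X.ι) :
    D.tw (A.X.lab i) = 1 := by
  have h := congrArg (fun f => entry f i i) hA
  simp only [entry_id, if_true] at h
  rw [← h]
  exact (if_pos rfl).symm

/-- Here `e` is the channel of the inner product in `(ij)l` and `f` that in `i(jl)`, so there is one
equation for each `e`. When `e` is not a summand of `A` the left side is zero. -/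
theorem mul_assoc_entry (A : Mon (Obj D)) {i j l : A.X.ι} {e d : S}
    (h1 : D.adm (A.X.lab i) (A.X.lab j) e = true) (h2 : D.adm e (A.X.lab l) d = true) (m : A.X.ι) :
    ∑ p, entry μ[A.X] ⟨(i, j, e), h1⟩ p *
        (if h : D.adm (A.X.lab p) (A.X.lab l) d = true then entry μ[A.X] ⟨(p, l, d), h⟩ m else 0) =
      ∑ f, if h : D.adm (A.X.lab j) (A.X.lab l) f = true ∧ D.adm (A.X.lab i) f d = true then
        D.F (A.X.lab i) (A.X.lab j) (A.X.lab l) d e f *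
          ∑ p, entry μ[A.X] ⟨(j, l, f), h.1⟩ p * (if h' : D.adm (A.X.lab i) (A.X.lab p) d = true then
            entry μ[A.X] ⟨(i, p, d), h'⟩ m else 0) else 0 := by
  have h := congrArg (fun g : PremodularData.tensorObj (PremodularData.tensorObj A.X A.X) A.X ⟶ A.X =>
    entry g ⟨(⟨(i, j, e), h1⟩, l, d), h2⟩ m) (MonObj.mul_assoc A.X)
  refine Eq.trans ?_ (h.trans ?_)
  · refine Eq.trans ?_ (entry_comp _ _ _ _).symm
    exact (strip_tensorHom_id A.X μ[A.X] (fun y => entry μ[A.X] y m)).symm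
  · refine (entry_comp _ _ _ _).trans ?_
    refine (strip_assocHom A.X A.X A.X (fun y => entry (A.X ◁ μ[A.X] ≫ μ[A.X]) y m)).trans ?_
    refine Finset.sum_congr rfl fun f _ => ?_
    split_ifs with hf
    · refine congrArg _ ((entry_comp _ _ _ _).trans ?_)
      exact strip_id_tensorHom A.X μ[A.X] (fun y => entry μ[A.X] y m)
    · rfl

theorem mul_one_entry (A : Mon (Obj D)) (i m : A.X.ι) :
    ∑ p, entry η[A.X] () p * (if h : D.adm (A.X.lab i) (A.X.lab p) (A.X.lab i) = true then
      entry μ[A.X] ⟨(i, p, A.X.lab i), h⟩ m else 0) = if i = m then 1 else 0 := by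
  have h0 : D.adm (A.X.lab i) D.one (A.X.lab i) = true := by simp [D.adm_one]
  have h := congrArg (fun g : PremodularData.tensorObj A.X (unitObj D) ⟶ A.X =>
    entry g ⟨(i, (), A.X.lab i), h0⟩ m) (MonObj.mul_one A.X)
  refine Eq.trans ?_ (h.trans ?_)
  · refine Eq.trans ?_ (entry_comp _ _ _ _).symm
    exact (strip_id_tensorHom A.X η[A.X] (fun y => entry μ[A.X] y m)).symm
  · rfl

/-- A label cannot occur in a connected separable algebra if associativity of the product of three
summands with this label forces their pairing to vanish. -/
theorem lab_ne_of_associativity {A : Mon (Obj D)} (hsep : A.IsSeparable)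
    (hconn : ∀ x : 𝟙_ (Obj D) ⟶ A.X, ∃ c : k, x = c • η[A.X]) {s e₁ e₂ : S} (hs : s ≠ D.one)
    (hsss : D.adm s s s = true) (hdual : ∀ t, D.adm s t D.one = true ↔ t = s)
    (hocc : ∀ i, D.adm s s (A.X.lab i) = true → A.X.lab i = D.one ∨ A.X.lab i = s)
    (he₁ : ∀ i, A.X.lab i ≠ e₁) (he₂ : ∀ i, A.X.lab i ≠ e₂)
    (ha₁ : D.adm s s e₁ = true ∧ D.adm e₁ s s = true)
    (ha₂ : D.adm s s e₂ = true ∧ D.adm e₂ s s = true)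
    (hF : D.F s s s s e₁ D.one * D.F s s s s e₂ s ≠ D.F s s s s e₂ D.one * D.F s s s s e₁ s)
    (i : A.X.ι) : A.X.lab i ≠ s := by
  rintro rfl
  have hss1 : D.adm (A.X.lab i) (A.X.lab i) D.one = true := (hdual _).2 rfl
  have hs1s : D.adm (A.X.lab i) D.one (A.X.lab i) = true := by simp [D.adm_one]
  -- The summand `i` pairs to zero with every summand `l`. Only those `l` with the same label as `i`
  -- can reach the unit; by connectedness their product along the unit is `c • η`, and the aim is `c
  -- = 0`.
  have key : ∀ l (hl : D.adm (A.X.lab i) (A.X.lab l) D.one = true) p,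
      entry μ[A.X] ⟨(i, l, D.one), hl⟩ p = 0 := by
    intro l hl
    have hls := (hdual _).1 hl
    obtain ⟨c, hc⟩ := hconn (mkHom (fun _ p => entry μ[A.X] ⟨(i, l, D.one), hl⟩ p)
      fun _ p hp => entry_eq_zero μ[A.X] (i := ⟨(i, l, D.one), hl⟩) hp)
    have hc' : ∀ p, entry μ[A.X] ⟨(i, l, D.one), hl⟩ p = c * entry η[A.X] () p := fun p =>
      congrArg (fun g : unitObj D ⟶ A.X => entry g () p) hc
    have hils : D.adm (A.X.lab i) (A.X.lab l) (A.X.lab i) = true := by rw [hls]; exact hsss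
    -- For an absent channel `e`, associativity of `i · i · l` leaves only the inner channels 1 and
    -- `s`. The first contributes `c`, by the unit law; the second contributes an unknown that is
    -- the same for all `e`.
    have hX : ∀ e, (∀ i, A.X.lab i ≠ e) →
        (D.adm (A.X.lab i) (A.X.lab i) e = true ∧ D.adm e (A.X.lab i) (A.X.lab i) = true) →
        0 = D.F (A.X.lab i) (A.X.lab i) (A.X.lab i) (A.X.lab i) e D.one * c +
          D.F (A.X.lab i) (A.X.lab i) (A.X.lab i) (A.X.lab i) e (A.X.lab i) *
            ∑ p, entry μ[A.X] ⟨(i, l, A.X.lab i), hils⟩ p *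
              (if h' : D.adm (A.X.lab i) (A.X.lab p) (A.X.lab i) = true then
                entry μ[A.X] ⟨(i, p, A.X.lab i), h'⟩ i else 0) := by
      intro e he ha
      have hFl : ∀ f, D.F (A.X.lab i) (A.X.lab i) (A.X.lab l) (A.X.lab i) e f =
          D.F (A.X.lab i) (A.X.lab i) (A.X.lab i) (A.X.lab i) e f := fun f => by rw [hls]
      have h := mul_assoc_entry A (i := i) (j := i) (l := l) (e := e) (d := A.X.lab i) ha.1
        (by rw [hls]; exact ha.2) i
      rw [Finset.sum_eq_zero (fun p _ => by
        rw [entry_eq_zero μ[A.X] (i := ⟨(i, i, e), ha.1⟩) (he p).symm, zero_mul]),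
        Fintype.sum_eq_add D.one (A.X.lab i) hs.symm] at h
      · refine h.trans ?_
        rw [dif_pos ⟨hl, hs1s⟩, dif_pos ⟨hils, hsss⟩, hFl, hFl]
        congr 2
        simp only [hc', mul_assoc, ← Finset.mul_sum]
        rw [mul_one_entry, if_pos rfl, mul_one]
      · rintro f ⟨hf1, hf2⟩
        split_ifs with hf
        · rw [Finset.sum_eq_zero, mul_zero]
          intro p _
          rw [entry_eq_zero μ[A.X] (i := ⟨(i, l, f), hf.1⟩), zero_mul]
          rintro (rfl : f = A.X.lab p)
          have := hf.1
          rw [hls] at this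
          exact (hocc p this).elim hf1 hf2
        · rfl
    have h1 := hX e₁ he₁ ha₁
    have h2 := hX e₂ he₂ ha₂
    have hc0 : c = 0 := by
      -- The second unknown is eliminated between the two equations, which leaves the determinant
      -- times `c`.
      refine (mul_eq_zero.1 ?_).resolve_left (sub_ne_zero.2 hF)
      linear_combination -D.F (A.X.lab i) (A.X.lab i) (A.X.lab i) (A.X.lab i) e₂ (A.X.lab i) * h1
        + D.F (A.X.lab i) (A.X.lab i) (A.X.lab i) (A.X.lab i) e₁ (A.X.lab i) * h2
    intro p
    rw [hc', hc0, zero_mul]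
  obtain ⟨A', _, κ, hκ⟩ := hsep
  -- The inclusion of the summand `i` now pairs to zero with `A`, so non-degeneracy makes it zero,
  -- which is absurd.
  let δ : simple D (A.X.lab i) ⟶ A.X := mkHom (fun _ j => if i = j then 1 else 0)
    fun _ j hj => if_neg fun hij => hj (congrArg A.X.lab hij)
  have hδ : δ = 0 := by
    refine eq_zero_of_whiskerRight_comp_traceForm hκ (hom_ext ?_)
    rintro ⟨⟨_, l, c⟩, h⟩ ⟨⟩
    by_cases hc : c = D.one
    · subst hc
      refine (entry_comp _ _ _ _).trans ?_
      refine (strip_tensorHom_id A.X δ (fun y => entry (μ[A.X] ≫ A.traceForm A') y ())).trans ?_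
      refine Finset.sum_eq_zero fun j _ => ?_
      by_cases hij : i = j
      · subst hij
        refine mul_eq_zero_of_right _ ((dif_pos h).trans ((entry_comp _ _ _ _).trans ?_))
        exact Finset.sum_eq_zero fun p _ => mul_eq_zero_of_left (key l h p) _
      · simp [δ, hij]
    · exact entry_eq_zero _ hc
  exact one_ne_zero ((if_pos rfl).symm.trans
    (congrArg (fun g : simple D (A.X.lab i) ⟶ A.X => entry g () i) hδ))

/-- A non-zero connected algebra which is a multiple of the unit object is the unit algebra. -/
theorem nonempty_iso_trivial {A : Mon (Obj D)} (h0 : ¬ Limits.IsZero A.X)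
    (hconn : ∀ x : 𝟙_ (Obj D) ⟶ A.X, ∃ c : k, x = c • η[A.X])
    (hlab : ∀ i, A.X.lab i = D.one) : Nonempty (A ≅ Mon.trivial (Obj D)) := by
  -- Each coordinate vector is a multiple of `η`. Hence no coordinate of `η` vanishes, and two
  -- different summands cannot coexist.
  have hη : ∀ p q, ∃ c, (if p = q then 1 else 0) = c * entry η[A.X] () q ∧
      1 = c * entry η[A.X] () p := by
    intro p q
    obtain ⟨c, hc⟩ := hconn (mkHom (fun _ q => if p = q then 1 else 0)
      fun _ q hq => absurd (hlab q).symm hq)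
    refine ⟨c, congrArg (fun g : unitObj D ⟶ A.X => entry g () q) hc, ?_⟩
    exact (if_pos rfl).symm.trans (congrArg (fun g : unitObj D ⟶ A.X => entry g () p) hc)
  have hne : ∀ p, entry η[A.X] () p ≠ 0 := fun p h => by
    obtain ⟨c, -, hc⟩ := hη p p
    rw [h, mul_zero] at hc
    exact one_ne_zero hc
  have hsub : ∀ p q : A.X.ι, p = q := by
    intro p q
    by_contra hpq
    obtain ⟨c, hc, hc'⟩ := hη p q
    rw [if_neg hpq, eq_comm, mul_eq_zero] at hc
    rw [hc.resolve_right (hne q), zero_mul] at hc'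
    exact one_ne_zero hc'
  obtain ⟨p₀⟩ : Nonempty A.X.ι := by
    by_contra h
    exact h0 ((Limits.IsZero.iff_id_eq_zero _).2 (hom_ext fun i => (h ⟨i⟩).elim))
  let f : Mon.trivial (Obj D) ⟶ A := default
  have hf : f.hom = η[A.X] := by
    have := IsMonHom.one_hom f.hom
    exact (Category.id_comp _).symm.trans this
  let g : A.X ⟶ 𝟙_ (Obj D) := mkHom (fun p _ => (entry η[A.X] () p)⁻¹) fun i _ h => absurd (hlab i) h
  have : IsIso ((Mon.forget (Obj D)).map f) := by
    have h1 : η[A.X] ≫ g = 𝟙 _ := hom_ext fun i j => by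
      refine (entry_comp _ _ _ _).trans ?_
      rw [Fintype.sum_eq_single p₀ fun q hq => absurd (hsub q p₀) hq]
      exact (mul_inv_cancel₀ (hne p₀)).trans (entry_id (unitObj D) () ()).symm
    have h2 : g ≫ η[A.X] = 𝟙 _ := hom_ext fun i j => by
      obtain rfl := hsub i j
      refine (entry_comp (Y := unitObj D) _ _ _ _).trans ?_
      rw [Fintype.sum_eq_single () fun q hq => absurd rfl hq, entry_id, if_pos rfl]
      exact inv_mul_cancel₀ (hne i)
    rw [← hf] at h1 h2
    exact ⟨g, h1, h2⟩
  have : IsIso f := isIso_of_reflects_iso f (Mon.forget (Obj D))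
  exact ⟨(asIso f).symm⟩

end CategoryTheory.Mon

/-! ### Products of Fibonacci categories without opposite parameters -/

section FibProductAnisotropic
open PremodularData
variable {k : Type w} [Field k]

theorem IsPrimitiveRoot.pow_five_eq_neg_one {u : k} (hu : IsPrimitiveRoot u 10) : u ^ 5 = -1 := by
  linear_combination (u + 1) * fib_rel hu

/-- Since `u ^ 5 = v ^ 5 = -1`, the product `u * v` is a fifth root of unity, and such a root with
square 1 is 1. -/
theorem mul_sq_ne_one_of_isPrimitiveRoot_ten [CharZero k] {u v : k} (hu : IsPrimitiveRoot u 10)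
    (hv : IsPrimitiveRoot v 10) (huv : u * v ≠ 1) : (u * v) ^ 2 ≠ 1 := by
  intro h
  have h5 : (u * v) ^ 5 = 1 := by
    rw [mul_pow, hu.pow_five_eq_neg_one, hv.pow_five_eq_neg_one]
    ring
  exact huv (by linear_combination h5 - u * v * ((u * v) ^ 2 + 1) * h)

variable {I : Type} [Fintype I]

/-- The rows of the Fibonacci block are `(α, 1)` and `(-α, -α)`, so passing from column 1 to column
`x` costs a factor `α` in row `x` and nothing in row 1. In factors where `s` is trivial both entries
are 1. -/
theorem pi_F_eq (α : I → k) {e s : I → Bool} (hes : ∀ i, e i = true → s i = true) :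
    ∏ i, fibF (α i) (s i) (s i) (s i) (s i) (e i) (s i) =
      (∏ i, fibF (α i) (s i) (s i) (s i) (s i) (e i) false) * ∏ i, if e i then α i else 1 := by
  rw [← Finset.prod_mul_distrib]
  refine Finset.prod_congr rfl fun i _ => ?_
  have := hes i
  revert this
  cases e i <;> cases s i <;> simp [fibF, fibAdm]

theorem pi_F_one_ne_zero {α : I → k} (hα : ∀ i, α i ≠ 0) {e s : I → Bool}
    (hes : ∀ i, e i = true → s i = true) :
    ∏ i, fibF (α i) (s i) (s i) (s i) (s i) (e i) false ≠ 0 := by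
  refine Finset.prod_ne_zero_iff.2 fun i _ => ?_
  have := hes i
  revert this
  cases e i <;> cases s i <;> simp [fibF, fibAdm, hα i]

/-- In a Deligne product of Fibonacci categories with parameters `w i` such that `w i * w j ≠ 1`
for all `i, j`, the unit object is the only summand of a connected separable ribbon algebra. -/
theorem lab_eq_one_of_isRibbon [DecidableEq I] [CharZero k] {w : I → k} (hw : ∀ i, IsPrimitiveRoot (w i) 10)
    (hww : ∀ i j, w i * w j ≠ 1) {A : Mon (Obj (pi fun i => fibData (w i) (hw i)))}
    (hsep : A.IsSeparable) (hrib : A.IsRibbon)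
    (hconn : ∀ x : 𝟙_ (Obj (pi fun i => fibData (w i) (hw i))) ⟶ A.X, ∃ c : k, x = c • η[A.X])
    (i : A.X.ι) : A.X.lab i = fun _ => false := by
  -- The twist of the simple object supported on `T` is the product of `w j ^ (-2)` over `T`, and a
  -- ribbon algebra only contains objects of twist 1.
  have htw : ∀ (T : Finset I), ∏ j ∈ T, (w j) ^ 2 ≠ 1 → ∀ i, A.X.lab i ≠ fun j => decide (j ∈ T) := by
    intro T hT i hi
    have h := hrib.tw_lab i
    rw [hi] at h
    change ∏ j, (if decide (j ∈ T) = true then (w j)⁻¹ ^ 2 else 1) = 1 at h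
    simp only [decide_eq_true_eq, Finset.prod_ite_mem, Finset.univ_inter, inv_pow,
      Finset.prod_inv_distrib, inv_eq_one] at h
    exact hT h
  have htw₁ : ∀ a i, A.X.lab i ≠ fun j => decide (j ∈ ({a} : Finset I)) := fun a =>
    htw {a} (by
      rw [Finset.prod_singleton]
      exact (hw a).pow_ne_one_of_pos_of_lt (by norm_num) (by norm_num))
  have htw₂ : ∀ a b, a ≠ b → ∀ i, A.X.lab i ≠ fun j => decide (j ∈ ({a, b} : Finset I)) :=
    fun a b hab => htw {a, b} (by
      rw [Finset.prod_pair hab, ← mul_pow]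
      exact mul_sq_ne_one_of_isPrimitiveRoot_ten (hw a) (hw b) (hww a b))
  have hα : ∀ i, w i + (w i)⁻¹ ≠ 0 := fun i h => by
    have := fib_golden (hw i)
    rw [h] at this
    norm_num at this
  have hα₁ : ∀ i, w i + (w i)⁻¹ ≠ 1 := fun i h => by
    have := fib_golden (hw i)
    rw [h] at this
    norm_num at this
  -- Induction over the pointwise order, that is, over inclusion of supports. Singletons are
  -- excluded by their twist; any other non-empty support contains two distinct factors `a` and `b`.
  have main : ∀ s : I → Bool, (s ≠ fun _ => false) → ∀ i, A.X.lab i ≠ s := by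
    intro s
    induction s using WellFoundedLT.induction with
    | ind s ih =>
    intro hs
    obtain ⟨a, ha⟩ : ∃ a, s a = true := by
      by_contra! h
      exact hs (funext fun j => by simpa using h j)
    by_cases hsa : s = fun j => decide (j ∈ ({a} : Finset I))
    · rw [hsa]
      exact htw₁ a
    obtain ⟨b, hb, hab⟩ : ∃ b, s b = true ∧ a ≠ b := by
      by_contra! h
      refine hsa (funext fun j => ?_)
      by_cases hj : s j = true
      · simp [← h j hj, ha]
      · have : j ≠ a := fun hja => hj (hja ▸ ha)
        simpa [this] using hj
    have h1 : ∀ j, decide (j ∈ ({a} : Finset I)) = true → s j = true := by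
      intro j hj
      simp only [Finset.mem_singleton, decide_eq_true_eq] at hj
      rw [hj, ha]
    have h2 : ∀ j, decide (j ∈ ({a, b} : Finset I)) = true → s j = true := by
      intro j hj
      simp only [Finset.mem_insert, Finset.mem_singleton, decide_eq_true_eq] at hj
      rcases hj with rfl | rfl <;> assumption
    have hadm : ∀ e : I → Bool, (∀ j, e j = true → s j = true) →
        (pi fun i => fibData (w i) (hw i)).adm s s e = true ∧
          (pi fun i => fibData (w i) (hw i)).adm e s s = true := by
      intro e he
      simp only [PremodularData.pi, decide_eq_true_eq, ← forall_and]
      intro j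
      have := he j
      revert this
      change _ → fibAdm _ _ _ = _ ∧ fibAdm _ _ _ = _
      cases e j <;> cases s j <;> simp [fibAdm]
    -- The channels `{a}` and `{a, b}` are contained in `s` and absent from `A` because of their
    -- twists. If `s` is `{a, b}` itself, the argument still applies.
    refine Mon.lab_ne_of_associativity hsep hconn (s := s)
      (e₁ := fun j => decide (j ∈ ({a} : Finset I)))
      (e₂ := fun j => decide (j ∈ ({a, b} : Finset I))) hs (hadm s fun _ h => h).1 ?_ ?_
      (htw₁ a) (htw₂ a b hab) (hadm _ h1) (hadm _ h2) ?_
    · intro t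
      simp only [PremodularData.pi, decide_eq_true_eq, funext_iff]
      refine forall_congr' fun j => ?_
      change fibAdm (s j) (t j) false = true ↔ _
      cases s j <;> cases t j <;> simp [fibAdm]
    · intro i hi
      simp only [PremodularData.pi, decide_eq_true_eq] at hi
      by_cases hone : A.X.lab i = fun _ => false
      · exact Or.inl hone
      right
      by_contra hne
      -- Every summand of `s ⊗ s` is supported inside `s`, so one different from 1 and `s` falls
      -- under the induction hypothesis.
      refine ih _ (lt_of_le_of_ne (fun j => ?_) hne) hone i rfl
      have := hi j
      change fibAdm _ _ _ = _ at this
      revert this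
      cases s j <;> cases A.X.lab i j <;> simp [fibAdm]
    · have e1 := pi_F_eq (fun i => w i + (w i)⁻¹) h1
      have e2 := pi_F_eq (fun i => w i + (w i)⁻¹) h2
      simp only [decide_eq_true_eq, Finset.prod_ite_mem, Finset.univ_inter, Finset.prod_singleton,
        Finset.prod_pair hab] at e1 e2
      have n1 := pi_F_one_ne_zero hα h1
      have n2 := pi_F_one_ne_zero hα h2
      change (∏ i, fibF (w i + (w i)⁻¹) (s i) (s i) (s i) (s i) (decide (i ∈ ({a} : Finset I))) false) *
          (∏ i, fibF (w i + (w i)⁻¹) (s i) (s i) (s i) (s i) (decide (i ∈ ({a, b} : Finset I))) (s i)) ≠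
        (∏ i, fibF (w i + (w i)⁻¹) (s i) (s i) (s i) (s i) (decide (i ∈ ({a, b} : Finset I))) false) *
          (∏ i, fibF (w i + (w i)⁻¹) (s i) (s i) (s i) (s i) (decide (i ∈ ({a} : Finset I))) (s i))
      rw [e1, e2]
      intro h
      -- The determinant is a non-zero multiple of `α_a * (α_b - 1)`, where `α ≠ 0, 1` by `α ^ 2 = α
      -- + 1`.
      refine mul_ne_zero (mul_ne_zero n1 n2) (mul_ne_zero (hα a) (sub_ne_zero.2 (hα₁ b))) ?_
      linear_combination h
  by_contra h
  exact main _ h i rfl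

/-- The family enters as `E` with an equation because a `Sum.elim` of Fibonacci data and Fibonacci
data at a `Sum.elim` of parameters agree only after a case split on the index. -/
theorem nonempty_iso_trivial_of_mul_ne_one [DecidableEq I] [CharZero k] [IsAlgClosed k] {w : I → k}
    (hw : ∀ i, IsPrimitiveRoot (w i) 10) (hww : ∀ i j, w i * w j ≠ 1)
    {E : I → PremodularData k Bool} (hE : E = fun i => fibData (w i) (hw i)) (A : Mon (Obj (pi E)))
    (hcomm : IsCommMonObj A.X) (hsep : A.IsSeparable) (hrib : A.IsRibbon)
    (hind : A.IsIndecomposable) : Nonempty (A ≅ Mon.trivial (Obj (pi E))) := by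
  subst hE
  have hconn := fun x => Mon.exists_eq_smul_one hsep hind x
  exact Mon.nonempty_iso_trivial hind.1 hconn (lab_eq_one_of_isRibbon hw hww hsep hrib hconn)

theorem FibProduct.nonempty_iso_trivial [CharZero k] [IsAlgClosed k] {u v : k}
    (hu : IsPrimitiveRoot u 10) (hv : IsPrimitiveRoot v 10) (ℓ m : ℕ) (huv : u * v ≠ 1)
    (A : Mon (FibProduct hu hv ℓ m)) (hcomm : IsCommMonObj A.X) (hsep : A.IsSeparable)
    (hrib : A.IsRibbon) (hind : A.IsIndecomposable) :
    Nonempty (A ≅ Mon.trivial (FibProduct hu hv ℓ m)) := by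
  -- Two factors with equal parameters also have to be compared; there the condition is automatic.
  have hself : ∀ {w : k}, IsPrimitiveRoot w 10 → w * w ≠ 1 := fun hw => by
    rw [← pow_two]
    exact hw.pow_ne_one_of_pos_of_lt (by norm_num) (by norm_num)
  refine nonempty_iso_trivial_of_mul_ne_one (w := Sum.elim (fun _ => u) fun _ => v)
    (by rintro (_ | _) <;> assumption) ?_ (funext (by rintro (_ | _) <;> rfl)) A hcomm hsep hrib hind
  rintro (_ | _) (_ | _)
  exacts [hself hu, huv, mul_comm u v ▸ huv, hself hv]

end FibProductAnisotropic

/-! ### Algebras from structure constants, and self-dual objects -/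

namespace PremodularData
variable {k : Type w} [Field k] {S : Type} [Fintype S] [DecidableEq S] {D : PremodularData k S}

/-- The inclusion of a summand isomorphic to the unit object. -/
def summandUnit (X : Obj D) (o : X.ι) (ho : X.lab o = D.one) : unitObj D ⟶ X :=
  mkHom (fun _ l => if o = l then 1 else 0)
    fun _ _ h => if_neg fun h' => h (ho.symm.trans (congrArg X.lab h'))

/-- The multiplication with given structure constants: `N i j l` is the coefficient of the product
of the summands `i` and `j` along the summand `l`. -/
def constantsMul (X : Obj D) (N : X.ι → X.ι → X.ι → k) : tensorObj X X ⟶ X :=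
  mkHom (fun p l => if p.1.2.2 = X.lab l then N p.1.1 p.1.2.1 l else 0) fun _ _ h => if_neg h

section Constants
variable {X : Obj D} {N : X.ι → X.ι → X.ι → k}

theorem summandUnit_constantsMul_left {o : X.ι} (ho : X.lab o = D.one)
    (hN : ∀ i l, N o i l = if i = l then 1 else 0) :
    tensorHom (summandUnit X o ho) (𝟙 X) ≫ constantsMul X N = leftHom X := by
  refine hom_ext ?_
  rintro ⟨⟨⟨⟩, i, d⟩, h⟩ l
  obtain rfl : X.lab i = d := of_decide_eq_true ((D.one_adm _ _).symm.trans h)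
  rw [entry_comp, strip_tensorHom_id, Fintype.sum_eq_single o]
  · have : D.adm (X.lab o) (X.lab i) (X.lab i) = true := by simp [ho, D.one_adm]
    rw [dif_pos this]
    by_cases hil : i = l <;> simp [summandUnit, constantsMul, leftHom, hN, hil]
  · intro j hj
    simp [summandUnit, hj.symm]

theorem summandUnit_constantsMul_right {o : X.ι} (ho : X.lab o = D.one)
    (hN : ∀ i l, N i o l = if i = l then 1 else 0) :
    tensorHom (𝟙 X) (summandUnit X o ho) ≫ constantsMul X N = rightHom X := by
  refine hom_ext ?_
  rintro ⟨⟨i, ⟨⟩, d⟩, h⟩ l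
  obtain rfl : X.lab i = d := of_decide_eq_true ((D.adm_one _ _).symm.trans h)
  rw [entry_comp, strip_id_tensorHom, Fintype.sum_eq_single o]
  · have : D.adm (X.lab i) (X.lab o) (X.lab i) = true := by simp [ho, D.adm_one]
    rw [dif_pos this]
    by_cases hil : i = l <;> simp [summandUnit, constantsMul, rightHom, hN, hil]
  · intro j hj
    simp [summandUnit, hj.symm]

/-- The sum over inner channels `f` collapses: each summand `p` receives only the channel `f = X.lab
p`. What remains is one scalar identity for each outer channel `e`. -/
theorem constantsMul_assoc
    (hN : ∀ i j l, N i j l ≠ 0 → D.adm (X.lab i) (X.lab j) (X.lab l) = true)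
    (hassoc : ∀ i j l m e, ∑ p, (if e = X.lab p then N i j p else 0) * N p l m =
      ∑ p, D.F (X.lab i) (X.lab j) (X.lab l) (X.lab m) e (X.lab p) * (N j l p * N i p m)) :
    tensorHom (constantsMul X N) (𝟙 X) ≫ constantsMul X N =
      assocHom X X X ≫ tensorHom (𝟙 X) (constantsMul X N) ≫ constantsMul X N := by
  have hdite : ∀ i j l, (if _ : D.adm (X.lab i) (X.lab j) (X.lab l) = true then N i j l else 0) =
      N i j l := fun i j l => by
    split_ifs with h
    · rfl
    · exact (not_not.1 (mt (hN i j l) h)).symm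
  refine hom_ext ?_
  rintro ⟨⟨⟨⟨i, j, e⟩, h1⟩, l, d⟩, h2⟩ m
  by_cases hd : d = X.lab m
  · subst hd
    have key : ∀ f h1 h2, entry (tensorHom (𝟙 X) (constantsMul X N) ≫ constantsMul X N)
        ⟨(i, ⟨(j, l, f), h1⟩, X.lab m), h2⟩ m =
        ∑ p, (if f = X.lab p then N j l p else 0) * N i p m := by
      intro f h1 h2
      rw [entry_comp, strip_id_tensorHom]
      simp only [constantsMul, entry_mkHom, if_true, hdite]
    rw [entry_comp, entry_comp, strip_tensorHom_id, strip_assocHom' (hN := key)]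
    simp only [constantsMul, entry_mkHom, if_true, hdite, hassoc, Finset.mul_sum]
    rw [Finset.sum_comm]
    refine Finset.sum_congr rfl fun p _ => ?_
    rw [Fintype.sum_eq_single (X.lab p)]
    · simp
    · intro f hf
      simp [hf]
  · rw [entry_eq_zero _ hd, entry_eq_zero _ hd]

theorem braidHom_constantsMul
    (hcomm : ∀ i j l, D.R (X.lab i) (X.lab j) (X.lab l) * N j i l = N i j l) :
    braidHom X X ≫ constantsMul X N = constantsMul X N := by
  refine hom_ext ?_
  rintro ⟨⟨i, j, c⟩, h⟩ l
  rw [entry_comp, strip_braidHom]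
  by_cases hc : c = X.lab l
  · subst hc
    simp [constantsMul, hcomm]
  · simp [constantsMul, hc]

end Constants

/-- The pairing of an object with itself which pairs each summand with itself. -/
def diagEv (X : Obj D) (a : X.ι → k) : tensorObj X X ⟶ unitObj D :=
  mkHom (fun p _ => if p.1.1 = p.1.2.1 ∧ p.1.2.2 = D.one then a p.1.1 else 0)
    fun _ _ h => if_neg fun h' => h h'.2

/-- The copairing of an object with itself which pairs each summand with itself. -/
def diagCoev (X : Obj D) (a : X.ι → k) : unitObj D ⟶ tensorObj X X :=
  mkHom (fun _ p => if p.1.1 = p.1.2.1 ∧ p.1.2.2 = D.one then a p.1.1 else 0)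
    fun _ _ h => if_neg fun h' => h h'.2.symm

theorem strip_diagCoev {X : Obj D} (hX : ∀ i, D.adm (X.lab i) (X.lab i) D.one = true) (a : X.ι → k)
    (N : (tensorObj X X).ι → k) :
    ∑ y, entry (diagCoev X a) () y * N y = ∑ i, a i * N ⟨(i, i, D.one), hX i⟩ := by
  rw [sum_TIdx]
  refine Finset.sum_congr rfl fun i _ => ?_
  rw [Fintype.sum_eq_single i, Fintype.sum_eq_single D.one]
  · simp [diagCoev, hX]
  · intro c hc
    simp [diagCoev, hc]
  · intro j hj
    simp [diagCoev, hj.symm]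

/-- In the zigzag on the summand `i` only the copy `i` of the copairing survives, with both inner
channels the unit. The zigzag is therefore the scalar `a i * b i` times the corner entry of the
inverse associativity matrix. -/
theorem whiskerLeft_diagCoev_diagEv {X : Obj D}
    (hX : ∀ i, D.adm (X.lab i) (X.lab i) D.one = true) {a b : X.ι → k}
    (hab : ∀ i, D.G (X.lab i) (X.lab i) (X.lab i) (X.lab i) D.one D.one * (a i * b i) = 1) :
    X ◁ (show 𝟙_ (Obj D) ⟶ X ⊗ X from diagCoev X a) ≫ (α_ X X X).inv ≫
      (show X ⊗ X ⟶ 𝟙_ (Obj D) from diagEv X b) ▷ X = (ρ_ X).hom ≫ (λ_ X).inv := by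
  change tensorHom (𝟙 X) (diagCoev X a) ≫ assocInv X X X ≫ tensorHom (diagEv X b) (𝟙 X) =
    rightHom X ≫ leftInv X
  refine hom_ext ?_
  rintro ⟨⟨i, ⟨⟩, d⟩, h⟩ ⟨⟨⟨⟩, m, d'⟩, h'⟩
  obtain rfl : X.lab i = d := of_decide_eq_true ((D.adm_one _ _).symm.trans h)
  obtain rfl : X.lab m = d' := of_decide_eq_true ((D.one_adm _ _).symm.trans h')
  have key : ∀ j h1 h2, entry (assocInv X X X ≫ tensorHom (diagEv X b) (𝟙 X))
      ⟨(i, ⟨(j, j, D.one), h1⟩, X.lab i), h2⟩ ⟨((), m, X.lab m), h'⟩ =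
      D.G (X.lab i) (X.lab j) (X.lab j) (X.lab i) D.one D.one *
        (if X.lab i = X.lab m then (if i = j then b i else 0) * (if j = m then 1 else 0) else 0) := by
    intro j h1 h2
    rw [entry_comp, strip_assocInv' (N' := fun e => if X.lab i = X.lab m then
      (if i = j ∧ e = D.one then b i else 0) * (if j = m then 1 else 0) else 0)
      (hN := fun e h1 h2 => by simp only [tensorHom, diagEv, entry_mkHom, entry_id])]
    rw [Fintype.sum_eq_single D.one]
    · simp
    · intro e he
      simp [he]
  rw [entry_comp, strip_id_tensorHom, strip_diagCoev hX, Fintype.sum_eq_single i]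
  · rw [dif_pos h, key, entry_comp, Fintype.sum_eq_single i]
    · by_cases him : i = m
      · subst him
        simpa [rightHom, leftInv, mul_left_comm] using hab i
      · simp [rightHom, leftInv, him]
    · intro j hj
      simp [rightHom, hj.symm]
  · intro j hj
    split_ifs with hh
    · rw [key]
      simp [hj.symm]
    · exact absurd h hh

theorem diagCoev_whiskerRight_diagEv {X : Obj D}
    (hX : ∀ i, D.adm (X.lab i) (X.lab i) D.one = true) {a b : X.ι → k}
    (hab : ∀ i, D.F (X.lab i) (X.lab i) (X.lab i) (X.lab i) D.one D.one * (a i * b i) = 1) :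
    (show 𝟙_ (Obj D) ⟶ X ⊗ X from diagCoev X a) ▷ X ≫ (α_ X X X).hom ≫
      X ◁ (show X ⊗ X ⟶ 𝟙_ (Obj D) from diagEv X b) = (λ_ X).hom ≫ (ρ_ X).inv := by
  change tensorHom (diagCoev X a) (𝟙 X) ≫ assocHom X X X ≫ tensorHom (𝟙 X) (diagEv X b) =
    leftHom X ≫ rightInv X
  refine hom_ext ?_
  rintro ⟨⟨⟨⟩, i, d⟩, h⟩ ⟨⟨m, ⟨⟩, d'⟩, h'⟩
  obtain rfl : X.lab i = d := of_decide_eq_true ((D.one_adm _ _).symm.trans h)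
  obtain rfl : X.lab m = d' := of_decide_eq_true ((D.adm_one _ _).symm.trans h')
  have key : ∀ j h1 h2, entry (assocHom X X X ≫ tensorHom (𝟙 X) (diagEv X b))
      ⟨(⟨(j, j, D.one), h1⟩, i, X.lab i), h2⟩ ⟨(m, (), X.lab m), h'⟩ =
      D.F (X.lab j) (X.lab j) (X.lab i) (X.lab i) D.one D.one *
        (if X.lab i = X.lab m then (if j = m then 1 else 0) * (if j = i then b j else 0) else 0) := by
    intro j h1 h2
    rw [entry_comp, strip_assocHom' (N' := fun f => if X.lab i = X.lab m then
      (if j = m then 1 else 0) * (if j = i ∧ f = D.one then b j else 0) else 0)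
      (hN := fun e h1 h2 => by simp only [tensorHom, diagEv, entry_mkHom, entry_id])]
    rw [Fintype.sum_eq_single D.one]
    · simp
    · intro e he
      simp [he]
  rw [entry_comp, strip_tensorHom_id, strip_diagCoev hX, Fintype.sum_eq_single i]
  · rw [dif_pos h, key, entry_comp, Fintype.sum_eq_single i]
    · by_cases him : i = m
      · subst him
        simpa [leftHom, rightInv, mul_left_comm] using hab i
      · simp [leftHom, rightInv, him]
    · intro j hj
      simp [leftHom, hj.symm]
  · intro j hj
    split_ifs with hh
    · rw [key]
      simp [hj]
    · exact absurd h hh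

/-- An object with self-dual summands is its own dual. -/
@[reducible] def diagExactPairing {X : Obj D} (hX : ∀ i, D.adm (X.lab i) (X.lab i) D.one = true) {a b : X.ι → k}
    (hF : ∀ i, D.F (X.lab i) (X.lab i) (X.lab i) (X.lab i) D.one D.one * (a i * b i) = 1)
    (hG : ∀ i, D.G (X.lab i) (X.lab i) (X.lab i) (X.lab i) D.one D.one * (a i * b i) = 1) :
    ExactPairing X X where
  coevaluation' := diagCoev X a
  evaluation' := diagEv X b
  coevaluation_evaluation' := whiskerLeft_diagCoev_diagEv hX hG
  evaluation_coevaluation' := diagCoev_whiskerRight_diagEv hX hF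

theorem diagCoev_braidHom_diagEv {X : Obj D} (hX : ∀ i, D.adm (X.lab i) (X.lab i) D.one = true)
    (a b : X.ι → k) : entry (diagCoev X a ≫ braidHom X X ≫ diagEv X b) () () =
      ∑ i, a i * (D.R (X.lab i) (X.lab i) D.one * b i) := by
  rw [entry_comp, strip_diagCoev hX]
  refine Finset.sum_congr rfl fun i _ => ?_
  rw [entry_comp, strip_braidHom]
  simp [diagEv]

end PremodularData

/-! ### Criteria for separability and simplicity -/

namespace CategoryTheory.Mon
open PremodularData
variable {k : Type w} [Field k] {S : Type} [Fintype S] [DecidableEq S] {D : PremodularData k S}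

/-- An algebra with pairwise different self-dual summands is separable if each summand pairs
non-trivially with itself and the global dimension of the algebra does not vanish. -/
theorem isSeparable_of_diag {A : Mon (Obj D)} (hinj : Function.Injective A.X.lab)
    (hX : ∀ i, D.adm (A.X.lab i) (A.X.lab i) D.one = true)
    (hX' : ∀ i j, D.adm (A.X.lab i) (A.X.lab j) D.one = true → i = j) {o : A.X.ι}
    (ho : A.X.lab o = D.one) (hη : η[A.X] = summandUnit A.X o ho)
    (hμ : ∀ i, entry μ[A.X] ⟨(i, i, D.one), hX i⟩ o ≠ 0)
    (hF : ∀ i, D.F (A.X.lab i) (A.X.lab i) (A.X.lab i) (A.X.lab i) D.one D.one ≠ 0)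
    (hG : ∀ i, D.G (A.X.lab i) (A.X.lab i) (A.X.lab i) (A.X.lab i) D.one D.one =
      D.F (A.X.lab i) (A.X.lab i) (A.X.lab i) (A.X.lab i) D.one D.one)
    (hdim : ∑ i, (D.F (A.X.lab i) (A.X.lab i) (A.X.lab i) (A.X.lab i) D.one D.one)⁻¹ *
      D.R (A.X.lab i) (A.X.lab i) D.one ≠ 0) : A.IsSeparable := by
  let a : A.X.ι → k := fun i =>
    (D.F (A.X.lab i) (A.X.lab i) (A.X.lab i) (A.X.lab i) D.one D.one)⁻¹
  -- The evaluation is normalised to 1; the snake identities then force the coevaluation to be the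
  -- inverse corner entry of `F`.
  let P : ExactPairing A.X A.X := diagExactPairing (a := a) (b := fun _ => 1) hX
    (fun i => by simp [a, hF i]) (fun i => by simp [a, hF i, hG i])
  set t := ∑ i, (D.F (A.X.lab i) (A.X.lab i) (A.X.lab i) (A.X.lab i) D.one D.one)⁻¹ *
      D.R (A.X.lab i) (A.X.lab i) D.one with ht
  -- By Schur's lemma the trace form lives on the only unit summand. Its value there is the trace of
  -- multiplication by 1, that is, the dimension `t` of `A`.
  have htr : ∀ i, entry (A.traceForm A.X) i () = if i = o then t else 0 := by
    intro i
    split_ifs with hi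
    · subst hi
      have h1 : η[A.X] ≫ A.traceForm A.X =
          η_ A.X A.X ≫ (β_ A.X A.X).hom ≫ ε_ A.X A.X := by
        rw [comp_traceForm, MonObj.one_mul, Iso.inv_hom_id, id_whiskerRight, Category.id_comp]
      have h2 := congrArg (fun g : unitObj D ⟶ unitObj D => entry g () ()) h1
      have h3 := diagCoev_braidHom_diagEv hX a fun _ => 1
      have h4 : entry (η[A.X] ≫ A.traceForm A.X) () () = entry (A.traceForm A.X) i () := by
        rw [hη]
        refine (entry_comp (X := unitObj D) _ _ _ _).trans ?_
        simp [summandUnit]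
      refine h4.symm.trans (h2.trans (h3.trans ?_))
      simp [ht, a]
    · exact entry_eq_zero (A.traceForm A.X) (j := ()) fun h => hi (hinj (h.trans ho.symm))
  let b : A.X.ι → k := fun i => entry μ[A.X] ⟨(i, i, D.one), hX i⟩ o * t
  have he : μ[A.X] ≫ A.traceForm A.X = diagEv A.X b := by
    refine hom_ext ?_
    rintro ⟨⟨i, j, c⟩, h⟩ ⟨⟩
    refine (entry_comp _ _ _ _).trans ?_
    rw [Fintype.sum_eq_single o fun l hl => by rw [htr, if_neg hl, mul_zero], htr, if_pos rfl]
    by_cases hc : c = D.one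
    · subst hc
      obtain rfl := hX' i j h
      simp [diagEv, b]
    · rw [entry_eq_zero μ[A.X] (i := ⟨(i, j, c), h⟩) (fun h' => hc (h'.trans ho)), zero_mul]
      simp [diagEv, hc]
  have hb : ∀ i, b i ≠ 0 := fun i => mul_ne_zero (hμ i) hdim
  -- The pairing is diagonal with non-zero entries `b`, so the diagonal copairing with `b` inverted
  -- and corrected by the corner of `F` is its inverse.
  refine ⟨A.X, P, diagCoev A.X fun i => a i * (b i)⁻¹, ?_⟩
  rw [he]
  have := whiskerLeft_diagCoev_diagEv (X := A.X) hX (a := fun i => a i * (b i)⁻¹) (b := b)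
    fun i => by
      rw [hG, mul_assoc, inv_mul_cancel₀ (hb i), mul_one]
      exact mul_inv_cancel₀ (hF i)
  have h := (ρ_ A.X).inv ≫= (this =≫ (λ_ A.X).hom)
  simp only [Category.assoc, Iso.inv_hom_id, Category.comp_id] at h
  exact h

/-- A projection of a product kills the other factor. If it is non-zero it is injective, so the
other factor is zero; if it is zero, so is its own target. -/
theorem IsSimple.isIndecomposable {C : Type*} [Category C] [MonoidalCategory C]
    [BraidedCategory C] [Limits.HasZeroMorphisms C] {A : Mon C} (hA : A.IsSimple) :
    A.IsIndecomposable := by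
  refine ⟨hA.1, fun B₁ B₂ p₁ p₂ ⟨h⟩ => ?_⟩
  obtain ⟨i₁, h₁, -⟩ := Limits.BinaryFan.IsLimit.lift' h (𝟙 B₁.X) 0
  obtain ⟨i₂, h₂, h₂'⟩ := Limits.BinaryFan.IsLimit.lift' h 0 (𝟙 B₂.X)
  change i₁ ≫ p₁.hom = _ at h₁
  change i₂ ≫ p₁.hom = _ at h₂
  change i₂ ≫ p₂.hom = _ at h₂'
  by_cases hp : p₁.hom = 0
  · left
    rw [hp, Limits.comp_zero] at h₁
    exact (Limits.IsZero.iff_id_eq_zero _).2 h₁.symm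
  · right
    have := hA.2 B₁ p₁ hp
    rw [Limits.zero_of_comp_mono p₁.hom h₂, Limits.zero_comp] at h₂'
    exact (Limits.IsZero.iff_id_eq_zero _).2 h₂'.symm

/-- An algebra with pairwise different summands, all of which pair non-trivially with themselves
into the unit, is simple. -/
theorem isSimple_of_diag {A : Mon (Obj D)} (hinj : Function.Injective A.X.lab)
    (hX : ∀ i, D.adm (A.X.lab i) (A.X.lab i) D.one = true) {o : A.X.ι}
    (ho : A.X.lab o = D.one) (hη : η[A.X] = summandUnit A.X o ho)
    (hμ : ∀ i, entry μ[A.X] ⟨(i, i, D.one), hX i⟩ o ≠ 0) : A.IsSimple := by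
  refine ⟨fun h => ?_, fun B f hf => ?_⟩
  · have := congrArg (fun g => entry g o o) ((Limits.IsZero.iff_id_eq_zero _).1 h)
    simp [entry_id] at this
  -- If `f` killed the unit summand, the unit of `B` would be zero, and with it `B` and `f`.
  have hfo : ∃ b, entry f.hom o b ≠ 0 := by
    by_contra! h
    have h1 : η[A.X] ≫ f.hom = 0 := hom_ext fun _ b => by
      rw [hη]
      refine (entry_comp (X := unitObj D) _ _ _ _).trans ?_
      rw [Fintype.sum_eq_single o]
      · rw [h, mul_zero]
        rfl
      · intro l hl
        simp [summandUnit, hl.symm]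
    rw [IsMonHom.one_hom] at h1
    have h2 : 𝟙 B.X = 0 := by
      rw [← Iso.inv_hom_id (λ_ B.X), ← MonObj.one_mul, h1]
      simp
    exact hf (by rw [← Category.comp_id f.hom, h2, Limits.comp_zero])
  -- The square of the summand `i` has a non-zero component at the unit, where `f` does not vanish;
  -- multiplicativity then keeps `f` from killing `i`.
  have hrow : ∀ i, ∃ b, entry f.hom i b ≠ 0 := by
    intro i
    by_contra! h
    obtain ⟨b, hb⟩ := hfo
    have h1 := congrArg (fun g : PremodularData.tensorObj A.X A.X ⟶ B.X =>
      entry g ⟨(i, i, D.one), hX i⟩ b) (IsMonHom.mul_hom f.hom)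
    have h2 : entry (μ[A.X] ≫ f.hom) ⟨(i, i, D.one), hX i⟩ b =
        entry μ[A.X] ⟨(i, i, D.one), hX i⟩ o * entry f.hom o b := by
      refine (entry_comp _ _ _ _).trans (Fintype.sum_eq_single o fun l hl => ?_)
      rw [entry_eq_zero μ[A.X] (i := ⟨(i, i, D.one), hX i⟩)
        (fun h' => hl (hinj (h'.symm.trans ho.symm))), zero_mul]
    have h3 : entry ((f.hom ⊗ₘ f.hom) ≫ μ[B.X]) ⟨(i, i, D.one), hX i⟩ b = 0 := by
      refine (entry_comp _ _ _ _).trans (Finset.sum_eq_zero fun q _ => mul_eq_zero_of_left ?_ _)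
      change (if _ then entry f.hom i _ * _ else 0) = 0
      rw [h, zero_mul, ite_self]
    exact mul_ne_zero (hμ i) hb (h2.symm.trans (h1.trans h3))
  -- As the labels of `A` are distinct, column `b` of `f` meets only row `i`, so the entry of `g` at
  -- `i` can be read off from `g ≫ f`.
  refine ⟨fun {Z} g h hgh => hom_ext fun z i => ?_⟩
  obtain ⟨b, hb⟩ := hrow i
  have hlab : A.X.lab i = B.X.lab b := not_not.1 (mt (entry_eq_zero f.hom) hb)
  have h1 : ∀ g : Z ⟶ A.X, entry (g ≫ f.hom) z b = entry g z i * entry f.hom i b := fun g => by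
    rw [entry_comp, Fintype.sum_eq_single i fun l hl => by
      rw [entry_eq_zero f.hom (fun h' => hl (hinj (h'.trans hlab.symm))), mul_zero]]
  exact mul_right_cancel₀ hb ((h1 g).symm.trans ((congrArg (fun g => entry g z b) hgh).trans (h1 h)))

end CategoryTheory.Mon

/-! ### The algebra on 1 ⊕ x₁x₂ for opposite parameters -/

section FibProductAlgebra
open PremodularData
variable {k : Type w} [Field k] {u : k} (hu : IsPrimitiveRoot u 10)

/-- The object `1 ⊕ x₁ ⊗ x₂` of `Fib_u ⊠ Fib_{u⁻¹}`. -/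
abbrev fibDiagonalObj : FibProduct hu hu.inv 1 1 :=
  ⟨Bool, fun b _ => b⟩

/-- The structure constants of the algebra `1 ⊕ x₁ ⊗ x₂`. -/
def fibDiagonalConstants (α : k) (i j l : Bool) : k :=
  -- With the product `x · x → x` scaled to 1, the mixed channel `(x, 1)`, absent from the algebra,
  -- requires `-α ^ 2 - α * N = 0` for the coefficient `N` of `x · x → 1`; hence `N = -α`.
  if fibAdm i j l then (if i && j && !l then -α else 1) else 0

/-- `e₁` and `e₂` are the channels in the two factors, each of which contributes one copy of the
same matrix. The left side is zero unless they agree. -/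
theorem fibDiagonalConstants_assoc {α : k} (hα : α ^ 2 = α + 1) (i j l m e₁ e₂ : Bool) :
    ∑ p, (if e₁ = p ∧ e₂ = p then fibDiagonalConstants α i j p else 0) *
        fibDiagonalConstants α p l m =
      ∑ p, fibF α i j l m e₁ p * fibF α i j l m e₂ p *
        (fibDiagonalConstants α j l p * fibDiagonalConstants α i p m) := by
  have h3 : α ^ 3 = 2 * α + 1 := by linear_combination (α + 1) * hα
  revert i j l m e₁ e₂
  rintro (_ | _) (_ | _) (_ | _) (_ | _) (_ | _) (_ | _) <;>
    simp [fibDiagonalConstants, fibF, fibAdm] <;>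
    first | ring1 | linear_combination hα | linear_combination -hα |
      linear_combination α * hα

theorem fibProductData_F (i j l m p : Bool) (e : Fin 1 ⊕ Fin 1 → Bool) :
    (fibProductData hu hu.inv 1 1).F (fun _ => i) (fun _ => j) (fun _ => l) (fun _ => m) e
        (fun _ => p) =
      fibF (u + u⁻¹) i j l m (e (.inl 0)) p * fibF (u + u⁻¹) i j l m (e (.inr 0)) p := by
  simp only [PremodularData.pi, Fintype.prod_sum_type]
  simp [fibData, add_comm]

theorem fibProductData_adm (i j l : Bool) :
    (fibProductData hu hu.inv 1 1).adm (fun _ => i) (fun _ => j) (fun _ => l) = fibAdm i j l := by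
  rw [Bool.eq_iff_iff]
  simp [PremodularData.pi, fibData]

/-- The braiding eigenvalues for `u` and `u⁻¹` are inverse to each other, so on the diagonal objects
they cancel. This makes symmetric structure constants commutative. -/
theorem fibProductData_R (i j l : Bool) :
    (fibProductData hu hu.inv 1 1).R (fun _ => i) (fun _ => j) (fun _ => l) = 1 := by
  simp only [PremodularData.pi, Fintype.prod_sum_type]
  have h0 : u ≠ 0 := hu.ne_zero (by norm_num)
  cases i <;> cases j <;> cases l <;> simp [fibData, fibR, h0]

theorem fibProductData_one : (fibProductData hu hu.inv 1 1).one = fun _ => false :=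
  funext (by rintro (_ | _) <;> rfl)

instance fibDiagonalMonObj : MonObj (fibDiagonalObj hu) where
  one := summandUnit (fibDiagonalObj hu) false (fibProductData_one hu).symm
  mul := constantsMul (fibDiagonalObj hu) (fibDiagonalConstants (u + u⁻¹))
  one_mul := summandUnit_constantsMul_left _
    (by rintro (_ | _) (_ | _) <;> simp [fibDiagonalConstants, fibAdm])
  mul_one := summandUnit_constantsMul_right _
    (by rintro (_ | _) (_ | _) <;> simp [fibDiagonalConstants, fibAdm])
  mul_assoc := constantsMul_assoc
    (by
      intro i j l h
      refine (fibProductData_adm hu i j l).trans ?_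
      by_contra h'
      exact h (if_neg h'))
    (by
      intro i j l m e
      have h := fibDiagonalConstants_assoc (fib_golden hu) i j l m (e (.inl 0)) (e (.inr 0))
      have he : ∀ p : Bool, e = (fun _ => p) ↔ e (.inl 0) = p ∧ e (.inr 0) = p := by
        intro p
        simp [funext_iff]
      simp only [fibProductData_F, he]
      exact h)

/-- The commutative algebra `1 ⊕ x₁ ⊗ x₂` in `Fib_u ⊠ Fib_{u⁻¹}`. -/
abbrev fibDiagonalAlgebra : Mon (FibProduct hu hu.inv 1 1) := ⟨fibDiagonalObj hu⟩

theorem fibDiagonalConstants_comm (α : k) (i j l : Bool) :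
    fibDiagonalConstants α j i l = fibDiagonalConstants α i j l := by
  cases i <;> cases j <;> cases l <;> rfl

instance fibDiagonalAlgebra_isCommMonObj : IsCommMonObj (fibDiagonalObj hu) where
  mul_comm := braidHom_constantsMul fun i j l =>
    (congrArg (· * _) (fibProductData_R hu i j l)).trans
      ((one_mul _).trans (fibDiagonalConstants_comm _ i j l))

theorem fibDiagonalAlgebra_isRibbon : (fibDiagonalAlgebra hu).IsRibbon := by
  have htw : ∀ i : Bool, (fibProductData hu hu.inv 1 1).tw (fun _ => i) = 1 := by
    intro i
    have h0 : u ≠ 0 := hu.ne_zero (by norm_num)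
    simp only [PremodularData.pi, Fintype.prod_sum_type]
    cases i <;> simp [fibData, h0]
  refine hom_ext fun i j => ?_
  rw [entry_id]
  exact if_congr Iff.rfl (htw i) rfl

theorem fibDiagonalObj_lab_injective : Function.Injective (fibDiagonalObj hu).lab :=
  fun _ _ h => congrFun h (.inl 0)

theorem fibDiagonalObj_adm (i : (fibDiagonalObj hu).ι) :
    (fibProductData hu hu.inv 1 1).adm ((fibDiagonalObj hu).lab i) ((fibDiagonalObj hu).lab i)
      (fibProductData hu hu.inv 1 1).one = true := by
  rw [fibProductData_one]
  refine (fibProductData_adm hu i i false).trans ?_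
  cases i <;> rfl

theorem golden_ne_zero {α : k} (h : α ^ 2 = α + 1) : α ≠ 0 := by
  rintro rfl
  norm_num at h

theorem fibDiagonalAlgebra_pairing_ne_zero (i : (fibDiagonalObj hu).ι) :
    entry μ[fibDiagonalObj hu] ⟨(i, i, _), fibDiagonalObj_adm hu i⟩ false ≠ 0 := by
  have h : entry μ[fibDiagonalObj hu] ⟨(i, i, _), fibDiagonalObj_adm hu i⟩ false =
    fibDiagonalConstants (u + u⁻¹) i i false :=
    if_pos (e := (0 : k)) (fibProductData_one hu)
  rw [h]
  have := golden_ne_zero (fib_golden hu)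
  cases i <;> simp [fibDiagonalConstants, fibAdm, -neg_add_rev, this]

theorem fibDiagonalAlgebra_isSeparable [CharZero k] : (fibDiagonalAlgebra hu).IsSeparable := by
  have hα := fib_golden hu
  have hα0 := golden_ne_zero hα
  have hF : ∀ i : Bool, (fibProductData hu hu.inv 1 1).F (fun _ => i) (fun _ => i) (fun _ => i)
      (fun _ => i) (fun _ => false) (fun _ => false) = if i then (u + u⁻¹) ^ 2 else 1 := by
    intro i
    rw [fibProductData_F]
    cases i <;> simp [fibF, fibAdm]
    ring
  refine Mon.isSeparable_of_diag (o := false) (fibDiagonalObj_lab_injective hu)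
    (fibDiagonalObj_adm hu) ?_ (fibProductData_one hu).symm rfl (fibDiagonalAlgebra_pairing_ne_zero hu) ?_ ?_ ?_
  · intro i j h
    rw [fibProductData_one] at h
    have h' := (fibProductData_adm hu i j false).symm.trans h
    revert h'
    cases i <;> cases j <;> simp [fibAdm]
  · intro i h
    rw [fibProductData_one] at h
    have h' := (hF i).symm.trans h
    revert h'
    cases i <;> simp [hα0]
  · intro i
    simp only [PremodularData.pi]
    refine Finset.prod_congr rfl fun j _ => ?_
    rcases j with _ | _ <;> cases i <;> rfl
  · rw [fibProductData_one]
    intro h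
    have hR : ∀ i : Bool, (fibProductData hu hu.inv 1 1).R (fun _ => i) (fun _ => i)
      (fun _ => false) = 1 := fun i => fibProductData_R hu i i false
    have h' : ∑ i : Bool, ((fibProductData hu hu.inv 1 1).F (fun _ => i) (fun _ => i) (fun _ => i)
      (fun _ => i) (fun _ => false) (fun _ => false))⁻¹ * (fibProductData hu hu.inv 1 1).R
      (fun _ => i) (fun _ => i) (fun _ => false) = 0 := h
    simp only [hF, hR, Fintype.sum_bool] at h'
    simp only [if_true, Bool.false_eq_true, if_false, inv_one, mul_one] at h'
    have h2 := mul_inv_cancel₀ (pow_ne_zero 2 hα0)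
    -- If the dimension `1 + α⁻²` were zero, then `α ^ 2 = -1`; the golden relation would give `α =
    -- -2` and thus `4 = -1`.
    have h3 : (5 : k) = 0 := by
      have h4 : u + u⁻¹ = -2 := by
        linear_combination (u + u⁻¹) ^ 2 * h' - h2 - hα
      rw [h4] at hα
      linear_combination hα
    norm_num at h3

theorem fibDiagonalAlgebra_isSimple : (fibDiagonalAlgebra hu).IsSimple :=
  Mon.isSimple_of_diag (o := false) (fibDiagonalObj_lab_injective hu) (fibDiagonalObj_adm hu)
    (fibProductData_one hu).symm rfl (fibDiagonalAlgebra_pairing_ne_zero hu)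

theorem K0Class_fibDiagonalObj : K0Class (fibDiagonalObj hu) =
    Finsupp.single (fun _ => true) 1 + Finsupp.single (fun _ => false) 1 :=
  Fintype.sum_bool fun b : Bool => Finsupp.single (fun _ => b) (1 : ℤ)

theorem K0Class_fibProduct_unit : K0Class (𝟙_ (FibProduct hu hu.inv 1 1)) =
    Finsupp.single (fun _ => false) 1 :=
  (Fintype.sum_unique fun _ : Unit =>
    Finsupp.single (fibProductData hu hu.inv 1 1).one (1 : ℤ)).trans (by rw [fibProductData_one])

theorem K0Class_fibProduct_x_tensor_x : K0Class (FibProduct.x hu hu.inv 1 1 (Sum.inl 0) ⊗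
    FibProduct.x hu hu.inv 1 1 (Sum.inr 0)) = Finsupp.single (fun _ => true) 1 := by
  have hadm : ∀ c : Fin 1 ⊕ Fin 1 → Bool, (fibProductData hu hu.inv 1 1).adm
      (fun j => decide (j = Sum.inl 0)) (fun j => decide (j = Sum.inr 0)) c = true ↔
        c = fun _ => true := by
    intro c
    simp [PremodularData.pi, fibData, fibAdm, funext_iff]
  refine Fintype.sum_eq_single (⟨((), (), fun _ => true), (hadm _).2 rfl⟩ :
    TIdx (FibProduct.x hu hu.inv 1 1 (Sum.inl 0)) (FibProduct.x hu hu.inv 1 1 (Sum.inr 0))) ?_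
  rintro ⟨⟨⟨⟩, ⟨⟩, c⟩, h⟩ hne
  obtain rfl := (hadm c).1 h
  exact absurd rfl hne

/-- The classes in `K₀` differ in the coefficient of `x₁x₂`. -/
theorem fibDiagonalAlgebra_not_iso_trivial :
    ¬ Nonempty (fibDiagonalAlgebra hu ≅ Mon.trivial (FibProduct hu hu.inv 1 1)) := by
  rintro ⟨e⟩
  have h := K0Class_eq_of_iso ((Mon.forget (FibProduct hu hu.inv 1 1)).mapIso e)
  replace h : K0Class (fibDiagonalObj hu) = K0Class (𝟙_ (FibProduct hu hu.inv 1 1)) := h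
  rw [K0Class_fibDiagonalObj, K0Class_fibProduct_unit] at h
  simpa [Finsupp.single_apply, funext_iff] using congrArg (fun f => f fun _ => true) h

end FibProductAlgebra

theorem mainTheorem3 {k : Type*} [Field k] [IsAlgClosed k] [CharZero k] :
    (∀ (u v : k) (hu : IsPrimitiveRoot u 10) (hv : IsPrimitiveRoot v 10) (ℓ m : ℕ),
      u * v ≠ 1 → ∀ A : Mon (FibProduct hu hv ℓ m),
        IsCommMonObj A.X → A.IsSeparable → A.IsRibbon → A.IsIndecomposable →
          Nonempty (A ≅ Mon.trivial (FibProduct hu hv ℓ m))) ∧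
    (∀ (u : k) (hu : IsPrimitiveRoot u 10),
      ∃ A : Mon (FibProduct hu hu.inv 1 1),
        IsCommMonObj A.X ∧ A.IsSeparable ∧ A.IsRibbon ∧ A.IsSimple ∧ A.IsIndecomposable ∧
          PremodularData.K0Class A.X =
            PremodularData.K0Class (𝟙_ (FibProduct hu hu.inv 1 1)) +
              PremodularData.K0Class
                (FibProduct.x hu hu.inv 1 1 (Sum.inl 0) ⊗
                  FibProduct.x hu hu.inv 1 1 (Sum.inr 0)) ∧
          ¬ Nonempty (A ≅ Mon.trivial (FibProduct hu hu.inv 1 1))) :=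
  ⟨fun _ _ hu hv ℓ m huv => FibProduct.nonempty_iso_trivial hu hv ℓ m huv,
    fun _ hu => ⟨fibDiagonalAlgebra hu, fibDiagonalAlgebra_isCommMonObj hu,
      fibDiagonalAlgebra_isSeparable hu, fibDiagonalAlgebra_isRibbon hu,
      fibDiagonalAlgebra_isSimple hu, (fibDiagonalAlgebra_isSimple hu).isIndecomposable,
      by rw [K0Class_fibDiagonalObj, K0Class_fibProduct_unit, K0Class_fibProduct_x_tensor_x, add_comm],
      fibDiagonalAlgebra_not_iso_trivial hu⟩⟩
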